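/- \textbf{Setting.} Let $I$ be a finite set of $n\ge 2$ agents. Agent $i$ has a finite nonempty set of actions $A_i$ and a deterministic utility $U_i:\prod_j A_j\to[0,1]$. The game is \emph{interdependent}: for every action profile $\mathbf a$ and every $\emptyset\subsetneq J\subsetneq I$ there are an agent $i\notin J$ and actions $a'_J$ such that $U_i(a'_J,a_{-J})\ne U_i(\mathbf a)$. Let $F:[0,1]\to\mathbb R$ be non-increasing, let $G(v,u)\ge 0$ (for $0\le v<u\le 1$) be non-decreasing in $v$ and non-increasing in $u$, and let $c_F\in(0,1)$. \textbf{The IODL process} with perturbation $\epsilon\in(0,1)$ is the homogeneous Markov chain in which each agent is either \emph{discontent}, or \emph{content} with a benchmark action $\bar a\in A_i$ and a benchmark utility $\bar u$ in the finite set of possible utilities. At each step the agents choose actions independently: a discontent agent plays a uniformly random action; a content agent plays $\bar a$ if $\bar u=1$, and if $\bar u<1$ it plays with probability $\epsilon$ a uniformly random action $a\ne\bar a$, and otherwise $\bar a$. Each agent $i$ then observes $u=U_i(\mathbf a)$, and the agents update independently as follows, where ``accept'' means becoming content with benchmark $(a,u)$, for $a$ its action just played. \begin{itemize} \item A discontent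 agent accepts with probability $\epsilon^{F(u)}$ if $F(u)>0$, or $c_F$ if $F(u)=0$; else it stays discontent. \item A content agent that played $a\ne\bar a$: if $u>\bar u$, it accepts with probability $\epsilon^{G(\bar u,u)}$ and else keeps its state; if $u\le\bar u$, it keeps its state. \item A content agent that played $\bar a$: it accepts if $u>\bar u$, keeps its state if $u=\bar u$, and becomes discontent if $u<\bar u$. \end{itemize} A state is \emph{aligned} if all agents are content and $\bar u_i=U_i(\bar{\mathbf a})$ for all $i$. It is \emph{optimal} if moreover $\bar u_i=1$ for all $i$. For an aligned state $x$ put $\widetilde W(x)=1-\sum_i F(\bar u_i)$. The set of \emph{stochastically stable states} is the smallest set $\mathcal S$ of states such that $\lim_{\epsilon\to0^+}\liminf_{k\to\infty}\mathbb P(X^\epsilon_k\in\mathcal S)=1$ for every initial distribution. \textbf{Theorem (IODL convergence).} Assume in addition that $0\le F(u)<\frac1n$ for all $u\in[0,1]$. Then: \begin{itemize} \item If an optimal state exists, then for every $\epsilon\in(0,1)$ and every initial distribution the IODL process converges almost surely to an optimal state; that is, almost surely there is an optimal state $x$ with $X^\epsilon_k=x$ for all large $k$. \item If there is no optimal state,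 then the set of stochastically stable states is exactly the set of aligned states that maximize $\widetilde W$ among all aligned states. \end{itemize} -/

import Mathlib

open Filter Topology MeasureTheory

noncomputable section

namespace IODL

/-! ### Markov chains on a finite state space -/

section Markov

variable {S : Type*}

/-- `X` is a homogeneous Markov chain with transition matrix `P`, with an arbitrary
initial distribution. -/
structure IsMarkovChain {Ω : Type*} [MeasurableSpace Ω] (P : Matrix S S ℝ)
    (μ : Measure Ω) (X : ℕ → Ω → S) : Prop where
  measurable : ∀ k s, MeasurableSet {ω | X k ω = s}
  step : ∀ (k : ℕ) (s : ℕ → S),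
    μ.real {ω | ∀ j ≤ k + 1, X j ω = s j} =
      μ.real {ω | ∀ j ≤ k, X j ω = s j} * P (s k) (s (k + 1))

open Classical in
/-- The probability that the chain with transition matrix `P` and initial distribution `p`
is in `T` at time `k`. -/
def probAt [Fintype S] (P : Matrix S S ℝ) (p : S → ℝ) (T : Set S) (k : ℕ) : ℝ :=
  ∑ y, if y ∈ T then Matrix.vecMul p (P ^ k) y else 0

/-- `T` is the set of stochastically stable states of the perturbed process `P`: the smallest
set `T` such that, for every initial distribution, the lower limit in `k` of the probability
of being in `T` at time `k` tends to `1` as the perturbation tends to `0`. -/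
def IsStochasticallyStableSet [Fintype S] (P : ℝ → Matrix S S ℝ) (T : Set S) : Prop :=
  IsLeast {T : Set S | ∀ p ∈ stdSimplex ℝ S,
    Tendsto (fun ε : ℝ => liminf (fun k : ℕ => probAt (P ε) p T k) atTop) (𝓝[>] 0) (𝓝 1)} T

end Markov

/-! ### Games and the states of the learning process -/

variable {ι : Type*} {A : ι → Type*}

/-- For every action profile and every nonempty proper set `J` of agents, the agents of `J`
can change the utility of some agent outside `J` by changing their own actions. -/
def Interdependent (U : ι → (∀ i, A i) → ℝ) : Prop :=
  ∀ (a : ∀ i, A i) (J : Set ι), J.Nonempty → J ≠ Set.univ →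
    ∃ i ∉ J, ∃ b : ∀ i, A i, (∀ j ∉ J, b j = a j) ∧ U i b ≠ U i a

/-- The finite set of all possible utilities. -/
abbrev Utility (U : ι → (∀ i, A i) → ℝ) : Type :=
  Set.range fun q : ι × (∀ i, A i) => U q.1 q.2

/-- The utility observed by agent `i` under the action profile `a`. -/
def obs (U : ι → (∀ i, A i) → ℝ) (i : ι) (a : ∀ i, A i) : Utility U :=
  ⟨U i a, (i, a), rfl⟩

/-- State of agent `i`: `none` is the discontent mood (no benchmark is kept), and
`some (b, v)` is the content mood with benchmark action `b` and benchmark utility `v`. -/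
abbrev AgentState (U : ι → (∀ i, A i) → ℝ) (i : ι) : Type _ := Option (A i × Utility U)

/-- Joint states of all agents. -/
abbrev State (U : ι → (∀ i, A i) → ℝ) : Type _ := ∀ i, AgentState U i

instance [Fintype ι] [∀ i, Fintype (A i)] (U : ι → (∀ i, A i) → ℝ) : Fintype (State U) := by
  classical
  haveI : Fintype (Utility U) := Set.fintypeRange _
  infer_instance

/-- All agents are content and their benchmark utilities are those of the benchmark
action profile. -/
def IsAligned (U : ι → (∀ i, A i) → ℝ) (x : State U) : Prop :=
  ∃ a : ∀ i, A i, ∀ i, x i = some (a i, obs U i a)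

/-- An aligned state in which every benchmark utility is `1`. -/
def IsOptimal (U : ι → (∀ i, A i) → ℝ) (x : State U) : Prop :=
  IsAligned U x ∧ ∀ i, ∃ (b : A i) (v : Utility U), x i = some (b, v) ∧ (v : ℝ) = 1

/-- Virtual welfare `1 - ∑ i, F (v i)`, with `v i` the benchmark utility of agent `i`.
(It is used on aligned states only, where all agents are content.) -/
def virtualWelfare [Fintype ι] (U : ι → (∀ i, A i) → ℝ) (F : ℝ → ℝ) (x : State U) : ℝ :=
  1 - ∑ i, (x i).elim 0 fun bv => F bv.2

/-! ### The policies and the process -/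

open Classical in
/-- Point mass at `s`, evaluated at `t`. -/
def dirac {S : Type*} (s t : S) : ℝ := if t = s then 1 else 0

/-- Go to `s` with probability `q`, else go to `s'`. -/
def mix {S : Type*} (q : ℝ) (s s' : S) (t : S) : ℝ := q * dirac s t + (1 - q) * dirac s' t

open Classical in
/-- Action policy: the probability that agent `i` in the given state plays `a`. A discontent
agent plays a uniformly random action. A content agent plays its benchmark action if its
benchmark utility is `1`; otherwise it explores with probability `ε` a uniformly random
action other than its benchmark action (if there is one), and else plays the latter. -/
def actionProb (U : ι → (∀ i, A i) → ℝ) (ε : ℝ) {i : ι} [Fintype (A i)] :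
    AgentState U i → A i → ℝ
  | none, _ => 1 / (Fintype.card (A i) : ℝ)
  | some (b, v), a =>
      let e : ℝ := if (v : ℝ) < 1 ∧ Nontrivial (A i) then ε else 0
      if a = b then 1 - e else e / ((Fintype.card (A i) : ℝ) - 1)

open Classical in
/-- Update policy: the distribution of the next state of an agent that is in the given state,
has played `a` and has observed `u`. -/
def updateProb (U : ι → (∀ i, A i) → ℝ) (F : ℝ → ℝ) (G : ℝ → ℝ → ℝ) (c ε : ℝ) {i : ι} :
    AgentState U i → A i → Utility U → AgentState U i → ℝ
  | none, a, u => mix (if 0 < F u then ε ^ F u else c) (some (a, u)) none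
  | some (b, v), a, u =>
      if a ≠ b then
        if (v : ℝ) < u then mix (ε ^ G v u) (some (a, u)) (some (b, v))
        else dirac (some (b, v))
      else
        if (v : ℝ) < u then dirac (some (a, u))
        else if (u : ℝ) = v then dirac (some (b, v))
        else dirac none

/-- Transition matrix of the process with perturbation factor `ε`: the agents independently
choose actions, observe the resulting utilities, and independently update their states. -/
def transition [Fintype ι] [DecidableEq ι] [∀ i, Fintype (A i)] (U : ι → (∀ i, A i) → ℝ)
    (F : ℝ → ℝ) (G : ℝ → ℝ → ℝ) (c ε : ℝ) : Matrix (State U) (State U) ℝ :=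
  fun x y => ∑ a : (∀ i, A i), (∏ i, actionProb U ε (x i) (a i)) *
    ∏ i, updateProb U F G c ε (x i) (a i) (obs U i a) (y i)

end IODL

end

/-! Let `D` be the state with all agents discontent, and let Φ be the sum of `F` over the benchmark
utilities of the content agents, so that the virtual welfare of an aligned state is 1 - Φ.

Interdependence drives the combinatorics (`IsRegular.reach`): discontent spreads to everybody, and
an aligned state that is not optimal can be upset by one exploring agent or replaced by an aligned
state of larger total utility. So each state leads to `D` or to an optimal state, while `D` leads to
every aligned state in one transition. If an optimal state exists, the absorbing optimal states are
thus accessible from everywhere, and the chain is absorbed almost surely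
(`IsMarkovChain.ae_eventually_eq`).

If there is none, `D` is accessible from everywhere and has a self-loop, so for each ε the law
converges to a stationary distribution π (`exists_tendsto_vecMul_pow`). Its asymptotics come from
balancing probability flux across sets. Put α = 1 on aligned states, where leaving requires an
exploration, and α = 0 elsewhere. Three facts suffice: a transition from z to another state z' has
probability O(ε^(α(z) + (Φ(z') - Φ(z))⁺)); every z leads to `D` by transitions of order at least
ε^α; and `D` leads to an aligned x with order at least ε^Φ(x). Flux balance across superlevel sets
of Φ gives ε^α(z) π(z) = O(ε^Φ(z) π(D)) (`IsStationaryFamily.isBigO_potential`), and balance at x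
gives π(D) = O(ε^(1 - Φ(x)) π(x)). So π(x) has the order of ε^(Φ(x) - 1) π(D) on aligned states. As
`F` < 1/n forces Φ < 1 there, states that are not aligned lose all weight, and among aligned states
only the minimizers of Φ keep it (`IsStationaryFamily.tendsto_one_iff`).

`DominatesRpow` carries both uses of a transition: positivity for every ε in (0, 1), and its order
as ε → 0. -/

noncomputable section

namespace IODL

open Matrix Relation

/-! ### Convergence to equilibrium of a finite chain -/

section Ergodic

variable {S : Type*} [Fintype S] [DecidableEq S] {P Q : Matrix S S ℝ}

lemma vecMul_mem_stdSimplex (hP : P ∈ rowStochastic ℝ S) {p : S → ℝ}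
    (hp : p ∈ stdSimplex ℝ S) : p ᵥ* P ∈ stdSimplex ℝ S := by
  refine ⟨nonneg_vecMul_of_mem_rowStochastic hP hp.1, ?_⟩
  simp only [vecMul, dotProduct]
  rw [Finset.sum_comm]
  simp_rw [← Finset.mul_sum, sum_row_of_mem_rowStochastic hP, mul_one]
  exact hp.2

/-- Doeblin's contraction: as `v` has total mass zero, subtracting `δ` from column `d` of `Q` does
not change the product, and it lowers the row sums of the still nonnegative matrix to `1 - δ`. -/
lemma sum_abs_vecMul_le (hQ : Q ∈ rowStochastic ℝ S) {d : S} {δ : ℝ}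
    (hδ : ∀ z, δ ≤ Q z d) {v : S → ℝ} (hv : ∑ z, v z = 0) :
    ∑ y, |(v ᵥ* Q) y| ≤ (1 - δ) * ∑ z, |v z| := by
  have key : ∀ y, (v ᵥ* Q) y = ∑ z, v z * (Q z y - if y = d then δ else 0) := by
    intro y
    simp only [vecMul, dotProduct, mul_sub, Finset.sum_sub_distrib]
    rw [← Finset.sum_mul, hv, zero_mul, sub_zero]
  have hnn : ∀ z y, 0 ≤ Q z y - if y = d then δ else 0 := by
    intro z y
    split_ifs with h
    · subst h; linarith [hδ z]
    · simpa using nonneg_of_mem_rowStochastic hQ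
  calc ∑ y, |(v ᵥ* Q) y|
      ≤ ∑ y, ∑ z, |v z| * (Q z y - if y = d then δ else 0) := by
        refine Finset.sum_le_sum fun y _ => ?_
        rw [key]
        refine (Finset.abs_sum_le_sum_abs _ _).trans_eq ?_
        exact Finset.sum_congr rfl fun z _ => by rw [abs_mul, abs_of_nonneg (hnn z y)]
    _ = (1 - δ) * ∑ z, |v z| := by
        rw [Finset.sum_comm, Finset.mul_sum]
        refine Finset.sum_congr rfl fun z _ => ?_
        rw [← Finset.mul_sum, Finset.sum_sub_distrib, sum_row_of_mem_rowStochastic hQ]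
        simp [mul_comm]

lemma sum_vecMul (hQ : Q ∈ rowStochastic ℝ S) (v : S → ℝ) : ∑ y, (v ᵥ* Q) y = ∑ z, v z := by
  simp only [vecMul, dotProduct]
  rw [Finset.sum_comm]
  simp_rw [← Finset.mul_sum, sum_row_of_mem_rowStochastic hQ, mul_one]

lemma sum_abs_vecMul_pow_le (hQ : Q ∈ rowStochastic ℝ S) {d : S} {δ : ℝ}
    (hδ : ∀ z, δ ≤ Q z d) (hδ1 : δ ≤ 1) {v : S → ℝ} (hv : ∑ z, v z = 0) (j : ℕ) :
    ∑ y, |(v ᵥ* Q ^ j) y| ≤ (1 - δ) ^ j * ∑ z, |v z| := by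
  induction j with
  | zero => simp
  | succ j ih =>
    rw [pow_succ, ← vecMul_vecMul]
    refine (sum_abs_vecMul_le hQ hδ ?_).trans ?_
    · rw [sum_vecMul (pow_mem hQ j), hv]
    · rw [pow_succ', mul_assoc]
      exact mul_le_mul_of_nonneg_left ih (by linarith)

lemma pow_add_pos (hP : P ∈ rowStochastic ℝ S) {m n : ℕ} {x y z : S}
    (hxy : 0 < (P ^ m) x y) (hyz : 0 < (P ^ n) y z) : 0 < (P ^ (m + n)) x z := by
  rw [pow_add, mul_apply]
  refine lt_of_lt_of_le (mul_pos hxy hyz)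
    (Finset.single_le_sum (f := fun j => (P ^ m) x j * (P ^ n) j z) (fun j _ => ?_)
      (Finset.mem_univ y))
  exact mul_nonneg (nonneg_of_mem_rowStochastic (pow_mem hP _))
    (nonneg_of_mem_rowStochastic (pow_mem hP _))

lemma exists_pow_pos (hP : P ∈ rowStochastic ℝ S) {x y : S}
    (h : ReflTransGen (fun x y => 0 < P x y) x y) : ∃ n, 0 < (P ^ n) x y := by
  induction h with
  | refl => exact ⟨0, by simp⟩
  | tail _ hbc ih =>
    obtain ⟨n, hn⟩ := ih
    exact ⟨n + 1, pow_add_pos hP hn (by simpa using hbc)⟩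

/-- If some state with a self-loop is accessible from everywhere, the entries of the column of
that state in some power of the matrix are bounded below. -/
lemma exists_pow_column_ge (hP : P ∈ rowStochastic ℝ S) {d : S} (hd : 0 < P d d)
    (hreach : ∀ z, ReflTransGen (fun x y => 0 < P x y) z d) :
    ∃ m, 0 < m ∧ ∃ δ > 0, ∀ z, δ ≤ (P ^ m) z d := by
  choose n hn using fun z => exists_pow_pos hP (hreach z)
  have hloop : ∀ k, 0 < (P ^ k) d d := by
    intro k
    induction k with
    | zero => simp
    | succ k ih => exact pow_add_pos hP ih (by simpa using hd)
  -- A common exponent for all starting states: the self-loop at `d` fills the remaining time. The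
  -- `+ 1` keeps `m` positive.
  set m := (∑ z, n z) + 1
  have hm : ∀ z, 0 < (P ^ m) z d := by
    intro z
    have hle : n z ≤ m := (Finset.single_le_sum (fun _ _ => Nat.zero_le _)
      (Finset.mem_univ z)).trans (Nat.le_succ _)
    have := pow_add_pos hP (hn z) (hloop (m - n z))
    rwa [Nat.add_sub_cancel' hle] at this
  have : Nonempty S := ⟨d⟩
  obtain ⟨z₀, hz₀⟩ := Finite.exists_min fun z => (P ^ m) z d
  exact ⟨m, Nat.succ_pos _, _, hm z₀, hz₀⟩

/-- Convergence to the stationary distribution. -/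
theorem exists_tendsto_vecMul_pow (hP : P ∈ rowStochastic ℝ S) {d : S} (hd : 0 < P d d)
    (hreach : ∀ z, ReflTransGen (fun x y => 0 < P x y) z d) :
    ∃ π ∈ stdSimplex ℝ S, π ᵥ* P = π ∧
      ∀ p ∈ stdSimplex ℝ S, Tendsto (fun k : ℕ => p ᵥ* P ^ k) atTop (𝓝 π) := by
  obtain ⟨m, hm, δ, hδ, hδP⟩ := exists_pow_column_ge hP hd hreach
  have hδ1 : δ ≤ 1 := (hδP d).trans (le_one_of_mem_rowStochastic (pow_mem hP m))
  -- One contraction per block of `m` steps; `2` bounds the ℓ¹ distance of two distributions.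
  set b : ℕ → ℝ := fun k => (1 - δ) ^ (k / m) * 2
  have hb : Tendsto b atTop (𝓝 0) := by
    have h1 := (tendsto_pow_atTop_nhds_zero_of_lt_one (r := 1 - δ) (by linarith)
      (by linarith)).comp (Nat.tendsto_div_const_atTop hm.ne')
    simpa [b, Function.comp_def] using h1.mul_const 2
  have hdist : ∀ p ∈ stdSimplex ℝ S, ∀ q ∈ stdSimplex ℝ S, ∀ k : ℕ,
      dist (p ᵥ* P ^ k) (q ᵥ* P ^ k) ≤ b k := by
    intro p hp q hq k
    have hv : ∑ z, (p - q) z = 0 := by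
      simp [Finset.sum_sub_distrib, hp.2, hq.2]
    have hsum : ∑ y, |((p - q) ᵥ* P ^ k) y| ≤ b k := by
      have hk : P ^ k = (P ^ m) ^ (k / m) * P ^ (k % m) := by
        rw [← pow_mul, ← pow_add, Nat.div_add_mod]
      rw [hk, ← vecMul_vecMul]
      -- The incomplete last block is only known not to expand.
      refine (sum_abs_vecMul_le (d := d) (δ := 0) (pow_mem hP _)
        (fun z => nonneg_of_mem_rowStochastic (pow_mem hP _)) ?_).trans ?_
      · rw [sum_vecMul (pow_mem (pow_mem hP _) _), hv]
      · rw [sub_zero, one_mul]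
        refine (sum_abs_vecMul_pow_le (pow_mem hP m) hδP hδ1 hv _).trans ?_
        refine mul_le_mul_of_nonneg_left ?_ (pow_nonneg (by linarith) _)
        calc ∑ z, |(p - q) z| ≤ ∑ z, (p z + q z) := by
              refine Finset.sum_le_sum fun z _ => ?_
              rw [Pi.sub_apply, abs_le]
              constructor <;> linarith [hp.1 z, hq.1 z]
          _ = 2 := by rw [Finset.sum_add_distrib, hp.2, hq.2]; norm_num
    rw [dist_pi_le_iff (mul_nonneg (pow_nonneg (by linarith) _) (by norm_num))]
    intro y
    rw [Real.dist_eq, ← Pi.sub_apply, ← sub_vecMul]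
    exact (Finset.single_le_sum (f := fun y => |((p - q) ᵥ* P ^ k) y|)
      (fun _ _ => abs_nonneg _) (Finset.mem_univ y)).trans hsum
  have hp₀ : Pi.single d 1 ∈ stdSimplex ℝ S := single_mem_stdSimplex ℝ d
  set p₀ : S → ℝ := Pi.single d 1
  have hmem : ∀ k, p₀ ᵥ* P ^ k ∈ stdSimplex ℝ S := fun k =>
    vecMul_mem_stdSimplex (pow_mem hP k) hp₀
  have hcauchy : CauchySeq fun k : ℕ => p₀ ᵥ* P ^ k := by
    refine cauchySeq_of_le_tendsto_0 b (fun n k N hn hk => ?_) hb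
    -- Both late laws are the laws after `N` steps from two other initial distributions, so `hdist`
    -- applies at time `N`.
    have e : ∀ j, N ≤ j → p₀ ᵥ* P ^ j = (p₀ ᵥ* P ^ (j - N)) ᵥ* P ^ N := by
      intro j hj
      rw [vecMul_vecMul, ← pow_add, Nat.sub_add_cancel hj]
    rw [e n hn, e k hk]
    exact hdist _ (hmem _) _ (hmem _) N
  obtain ⟨π, hπ⟩ := cauchySeq_tendsto_of_complete hcauchy
  refine ⟨π, (isClosed_stdSimplex ℝ S).mem_of_tendsto hπ (Eventually.of_forall hmem), ?_, ?_⟩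
  · have h1 : Tendsto (fun k : ℕ => (p₀ ᵥ* P ^ k) ᵥ* P) atTop (𝓝 (π ᵥ* P)) :=
      ((continuous_id.matrix_vecMul continuous_const).tendsto π).comp hπ
    have h2 := hπ.comp (tendsto_add_atTop_nat 1)
    refine tendsto_nhds_unique h1 (h2.congr fun k => ?_)
    simp [pow_succ, vecMul_vecMul]
  · intro p hp
    refine tendsto_of_tendsto_of_dist hπ ?_
    exact squeeze_zero (fun _ => dist_nonneg) (fun k => hdist _ hp₀ _ hp k) hb

end Ergodic

/-! ### Almost sure absorption -/

section Absorption

variable {S : Type*}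

lemma IsMarkovChain.measurableSet_forall {Ω : Type*} [MeasurableSpace Ω] {P : Matrix S S ℝ}
    {μ : Measure Ω} {X : ℕ → Ω → S} (hX : IsMarkovChain P μ X) (k : ℕ) (s : ℕ → S) :
    MeasurableSet {ω | ∀ j ≤ k, X j ω = s j} := by
  simp only [Set.ofPred_forall]
  exact MeasurableSet.iInter fun j => MeasurableSet.iInter fun _ => hX.measurable j _

variable [Fintype S]

/-- The joint law of two successive states. -/
lemma IsMarkovChain.real_inter {Ω : Type*} [MeasurableSpace Ω] {P : Matrix S S ℝ}
    {μ : Measure Ω} [IsProbabilityMeasure μ] {X : ℕ → Ω → S} (hX : IsMarkovChain P μ X)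
    (k : ℕ) (x y : S) :
    μ.real {ω | X k ω = x ∧ X (k + 1) ω = y} = μ.real {ω | X k ω = x} * P x y := by
  classical
  let g : Ω → (Fin (k + 1) → S) := fun ω j => X j ω
  -- Decomposition over the trajectories up to time `k`; the default value `y` makes time `k + 1`
  -- the prescribed arrival in `y`.
  let ext : (Fin (k + 1) → S) → ℕ → S := fun s j =>
    if h : j < k + 1 then s ⟨j, h⟩ else y
  have hg : ∀ s, g ⁻¹' {s} = {ω | ∀ j ≤ k, X j ω = ext s j} := by
    intro s
    ext ω
    simp only [Set.mem_preimage, Set.mem_singleton_iff, Set.mem_ofPred_eq, g, ext, funext_iff]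
    constructor
    · intro h j hj
      rw [dif_pos (Nat.lt_succ_of_le hj)]
      exact h ⟨j, Nat.lt_succ_of_le hj⟩
    · intro h j
      have hj := h j (Nat.le_of_lt_succ j.2)
      rwa [dif_pos j.2] at hj
  have hgm : ∀ s, MeasurableSet (g ⁻¹' {s}) := fun s => by
    rw [hg]; exact hX.measurableSet_forall k _
  let K : Finset (Fin (k + 1) → S) := Finset.univ.filter fun s => s (Fin.last k) = x
  have hK : g ⁻¹' (K : Set (Fin (k + 1) → S)) = {ω | X k ω = x} := by
    ext ω; simp [K, g]
  let E : Set Ω := {ω | X (k + 1) ω = y}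
  have h1 : μ.real {ω | X k ω = x} = ∑ s ∈ K, μ.real (g ⁻¹' {s}) := by
    rw [sum_measureReal_preimage_singleton K (fun s _ => hgm s), hK]
  have h2 : μ.real {ω | X k ω = x ∧ X (k + 1) ω = y} =
      ∑ s ∈ K, (μ.restrict E).real (g ⁻¹' {s}) := by
    rw [sum_measureReal_preimage_singleton K (fun s _ => hgm s), hK,
      measureReal_restrict_apply (hX.measurable k x)]
    rfl
  rw [h1, h2, Finset.sum_mul]
  refine Finset.sum_congr rfl fun s hs => ?_
  rw [measureReal_restrict_apply (hgm s), hg]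
  have hs' : ext s k = x := by
    have := (Finset.mem_filter.1 hs).2
    simpa [ext, Fin.last] using this
  have hy : ext s (k + 1) = y := by simp [ext]
  have := hX.step k (ext s)
  rw [hs', hy] at this
  rw [← this]
  congr 1
  ext ω
  simp only [Set.mem_inter_iff, Set.mem_ofPred_eq, E]
  constructor
  · rintro ⟨h, h'⟩ j hj
    rcases Nat.le_succ_iff.1 hj with h'' | rfl
    · exact h j h''
    · rw [hy]; exact h'
  · intro h
    exact ⟨fun j hj => h j (hj.trans (Nat.le_succ k)), by rw [← hy]; exact h (k + 1) le_rfl⟩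

lemma IsMarkovChain.real_succ [DecidableEq S] {Ω : Type*} [MeasurableSpace Ω]
    {P : Matrix S S ℝ} {μ : Measure Ω} [IsProbabilityMeasure μ] {X : ℕ → Ω → S}
    (hX : IsMarkovChain P μ X) (k : ℕ) :
    (fun y => μ.real {ω | X k ω = y}) = (fun y => μ.real {ω | X 0 ω = y}) ᵥ* P ^ k := by
  induction k with
  | zero => simp
  | succ k ih =>
    rw [pow_succ, ← vecMul_vecMul, ← ih]
    ext y
    simp only [vecMul, dotProduct, ← hX.real_inter]
    have h := sum_measureReal_preimage_singleton (μ := μ.restrict {ω | X (k + 1) ω = y})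
      Finset.univ (f := X k) (fun s _ => hX.measurable k s)
    rw [Finset.coe_univ, Set.preimage_univ, measureReal_restrict_apply MeasurableSet.univ,
      Set.univ_inter] at h
    rw [← h]
    refine Finset.sum_congr rfl fun x _ => ?_
    exact measureReal_restrict_apply (hX.measurable k x)

variable [DecidableEq S] {P : Matrix S S ℝ}

/-- If a set of absorbing states is accessible from everywhere, it is hit in the limit with
probability one, from every state. -/
lemma tendsto_pow_mulVec_indicator (hP : P ∈ rowStochastic ℝ S) {T : Set S}
    (habs : ∀ x ∈ T, P x x = 1)
    (hreach : ∀ z, ∃ x ∈ T, ReflTransGen (fun x y => 0 < P x y) z x) (z : S) :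
    Tendsto (fun k : ℕ => (P ^ k *ᵥ T.indicator 1) z) atTop (𝓝 1) := by
  have hnn : ∀ x y, 0 ≤ P x y := fun x y => nonneg_of_mem_rowStochastic hP
  have hzero : ∀ x ∈ T, ∀ y, y ≠ x → P x y = 0 := by
    intro x hx y hyx
    have h := sum_row_of_mem_rowStochastic hP x
    rw [← Finset.add_sum_erase _ _ (Finset.mem_univ x), habs x hx, add_eq_left,
      Finset.sum_eq_zero_iff_of_nonneg (fun _ _ => hnn _ _)] at h
    exact h y (Finset.mem_erase.2 ⟨hyx, Finset.mem_univ y⟩)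
  have hsucc : ∀ k z, (P ^ (k + 1) *ᵥ T.indicator 1) z =
      ∑ y, P z y * (P ^ k *ᵥ T.indicator 1) y := by
    intro k z
    rw [pow_succ', ← mulVec_mulVec]; rfl
  have honT : ∀ x ∈ T, ∀ k : ℕ, (P ^ k *ᵥ T.indicator 1) x = 1 := by
    intro x hx k
    induction k with
    | zero => simp [hx]
    | succ k ih =>
      rw [hsucc, Finset.sum_eq_single x (fun y _ hy => by rw [hzero x hx y hy, zero_mul])
        (by simp), habs x hx, ih, one_mul]
  have hmono : ∀ z, Monotone fun k : ℕ => (P ^ k *ᵥ T.indicator 1) z := by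
    intro z
    refine monotone_nat_of_le_succ fun k => ?_
    induction k generalizing z with
    | zero =>
      by_cases hz : z ∈ T
      · rw [honT z hz, honT z hz]
      · rw [hsucc]
        simp only [pow_zero, one_mulVec, Set.indicator_of_notMem hz]
        exact Finset.sum_nonneg fun y _ => mul_nonneg (hnn _ _)
          (Set.indicator_nonneg (fun _ _ => zero_le_one) _)
    | succ k ih =>
      rw [hsucc, hsucc (k + 1)]
      exact Finset.sum_le_sum fun y _ => mul_le_mul_of_nonneg_left (ih y) (hnn _ _)
  have hle : ∀ z (k : ℕ), (P ^ k *ᵥ T.indicator 1) z ≤ 1 := by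
    intro z k
    have hPk := pow_mem hP k
    rw [← sum_row_of_mem_rowStochastic hPk z]
    refine Finset.sum_le_sum fun y _ => mul_le_of_le_one_right
      (nonneg_of_mem_rowStochastic hPk) ?_
    exact Set.indicator_apply_le' (fun _ => le_rfl) (fun _ => zero_le_one)
  have hex : ∀ z, ∃ l, Tendsto (fun k : ℕ => (P ^ k *ᵥ T.indicator 1) z) atTop (𝓝 l) :=
    fun z => ⟨_, tendsto_atTop_ciSup (hmono z) ⟨1, by rintro _ ⟨k, rfl⟩; exact hle z k⟩⟩
  choose h hh using hex
  have hharm : ∀ z, h z = ∑ y, P z y * h y := by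
    intro z
    have h1 := (hh z).comp (tendsto_add_atTop_nat 1)
    have h2 : Tendsto (fun k => ∑ y, P z y * (P ^ k *ᵥ T.indicator 1) y) atTop
        (𝓝 (∑ y, P z y * h y)) := tendsto_finsetSum _ fun y _ => (hh y).const_mul _
    exact tendsto_nhds_unique (h1.congr fun k => hsucc k z) h2
  have hT : ∀ x ∈ T, h x = 1 := fun x hx =>
    tendsto_nhds_unique ((hh x).congr fun k => honT x hx k) tendsto_const_nhds
  have : Nonempty S := ⟨z⟩
  -- Minimum principle: the limit `h` is harmonic, so its minimum spreads along transitions until it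
  -- meets `T`, where `h` is `1`.
  obtain ⟨z₀, hz₀⟩ := Finite.exists_min h
  have hstep : ∀ x y, h x = h z₀ → 0 < P x y → h y = h z₀ := by
    intro x y hx hxy
    have h0 : ∑ w, P x w * (h w - h z₀) = 0 := by
      simp_rw [mul_sub, Finset.sum_sub_distrib, ← Finset.sum_mul]
      rw [← hharm, sum_row_of_mem_rowStochastic hP, hx]; ring
    rw [Finset.sum_eq_zero_iff_of_nonneg
      (fun w _ => mul_nonneg (hnn _ _) (sub_nonneg.2 (hz₀ w)))] at h0
    have := h0 y (Finset.mem_univ y)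
    rcases mul_eq_zero.1 this with h' | h'
    · exact absurd h' hxy.ne'
    · linarith
  obtain ⟨x, hxT, hzx⟩ := hreach z₀
  have hacc : ∀ y, ReflTransGen (fun x y => 0 < P x y) z₀ y → h y = h z₀ := by
    intro y hy
    induction hy with
    | refl => rfl
    | tail _ hbc ih => exact hstep _ _ ih hbc
  have hmin := hacc x hzx
  have : h z = 1 := le_antisymm
    (le_of_tendsto (hh z) (Eventually.of_forall fun k => hle z k))
    (by have := hz₀ z; rw [← hmin, hT x hxT] at this; exact this)
  rw [← this]
  exact hh z

/-- A finite Markov chain from all of whose states a set of absorbing states is accessible is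
almost surely eventually constant, with value in this set. -/
theorem IsMarkovChain.ae_eventually_eq {Ω : Type*} [MeasurableSpace Ω]
    {μ : Measure Ω} [IsProbabilityMeasure μ] {X : ℕ → Ω → S} (hX : IsMarkovChain P μ X)
    (hP : P ∈ rowStochastic ℝ S) {T : Set S} (habs : ∀ x ∈ T, P x x = 1)
    (hreach : ∀ z, ∃ x ∈ T, ReflTransGen (fun x y => 0 < P x y) z x) :
    ∀ᵐ ω ∂μ, ∃ x ∈ T, ∀ᶠ k in atTop, X k ω = x := by
  have hstay : ∀ᵐ ω ∂μ, ∀ k, ∀ x ∈ T, X k ω = x → X (k + 1) ω = x := by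
    rw [ae_all_iff]
    intro k
    have : ∀ x y : S, x ∈ T → y ≠ x → ∀ᵐ ω ∂μ, ¬ (X k ω = x ∧ X (k + 1) ω = y) := by
      intro x y hx hyx
      have h0 : P x y = 0 := by
        have h := sum_row_of_mem_rowStochastic hP x
        rw [← Finset.add_sum_erase _ _ (Finset.mem_univ x), habs x hx, add_eq_left,
          Finset.sum_eq_zero_iff_of_nonneg (fun _ _ => nonneg_of_mem_rowStochastic hP)] at h
        exact h y (Finset.mem_erase.2 ⟨hyx, Finset.mem_univ y⟩)
      have h := hX.real_inter k x y
      rw [h0, mul_zero, measureReal_eq_zero_iff] at h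
      rw [ae_iff]
      simpa using h
    have h2 : ∀ᵐ ω ∂μ, ∀ x y : S, x ∈ T → y ≠ x → ¬ (X k ω = x ∧ X (k + 1) ω = y) := by
      simp only [ae_all_iff]
      intro x y hx hy
      exact this x y hx hy
    filter_upwards [h2] with ω hω x hx hk
    by_contra hne
    exact hω x _ hx hne ⟨hk, rfl⟩
  have hhit : ∀ᵐ ω ∂μ, ∃ k, X k ω ∈ T := by
    have hmeas : ∀ k, MeasurableSet {ω | X k ω ∈ T} := by
      intro k
      have : {ω | X k ω ∈ T} = ⋃ x ∈ T, {ω | X k ω = x} := by ext; simp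
      rw [this]
      exact MeasurableSet.biUnion T.to_countable fun x _ => hX.measurable k x
    have hlaw : ∀ k, μ.real {ω | X k ω ∈ T} =
        ∑ x, μ.real {ω | X 0 ω = x} * (P ^ k *ᵥ T.indicator 1) x := by
      intro k
      classical
      have h := sum_measureReal_preimage_singleton (μ := μ)
        (Finset.univ.filter (· ∈ T)) (f := X k) (fun s _ => hX.measurable k s)
      have e : X k ⁻¹' ((Finset.univ.filter (· ∈ T) : Finset S) : Set S) = {ω | X k ω ∈ T} := by
        ext; simp
      rw [e] at h
      rw [← h]
      change _ = (fun y => μ.real {ω | X 0 ω = y}) ⬝ᵥ (P ^ k *ᵥ T.indicator 1)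
      rw [dotProduct_mulVec, ← hX.real_succ k, dotProduct, Finset.sum_filter]
      refine Finset.sum_congr rfl fun x _ => ?_
      by_cases hx : x ∈ T
      · simp [hx]; rfl
      · simp [hx]
    have hlim : Tendsto (fun k => μ.real {ω | X k ω ∈ T}) atTop (𝓝 1) := by
      have h1 : ∑ x, μ.real {ω | X 0 ω = x} = 1 := by
        have := sum_measureReal_preimage_singleton (μ := μ) Finset.univ (f := X 0)
          (fun s _ => hX.measurable 0 s)
        rw [Finset.coe_univ, Set.preimage_univ, probReal_univ] at this
        exact this
      rw [← h1]
      simp_rw [hlaw]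
      refine tendsto_finsetSum _ fun x _ => ?_
      simpa using (tendsto_pow_mulVec_indicator hP habs hreach x).const_mul
        (μ.real {ω | X 0 ω = x})
    have hU : μ.real (⋃ k, {ω | X k ω ∈ T}) = 1 := by
      refine le_antisymm measureReal_le_one (le_of_tendsto hlim (Eventually.of_forall fun k => ?_))
      exact measureReal_mono (Set.subset_iUnion (fun k => {ω | X k ω ∈ T}) k)
    have hmU : MeasurableSet (⋃ k, {ω | X k ω ∈ T}) := MeasurableSet.iUnion hmeas
    have hc : μ.real (⋃ k, {ω | X k ω ∈ T})ᶜ = 0 := by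
      rw [probReal_compl_eq_one_sub hmU, hU, sub_self]
    rw [measureReal_eq_zero_iff] at hc
    rw [ae_iff]
    convert hc using 2
    ext; simp
  filter_upwards [hstay, hhit] with ω h1 ⟨k, hk⟩
  refine ⟨X k ω, hk, eventually_atTop.2 ⟨k, fun j hj => ?_⟩⟩
  induction j, hj using Nat.le_induction with
  | base => rfl
  | succ j _ ih => exact h1 j _ hk ih

end Absorption

/-! ### Stationary distributions and flux as the perturbation vanishes -/

open Asymptotics

section Stationary

lemma isBigO_rpow_of_le {a b : ℝ} (h : b ≤ a) :
    (fun ε : ℝ => ε ^ a) =O[𝓝[>] 0] fun ε => ε ^ b := by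
  refine IsBigO.of_bound 1 ?_
  filter_upwards [Ioo_mem_nhdsGT (zero_lt_one' ℝ)] with ε hε
  rw [one_mul, Real.norm_of_nonneg (Real.rpow_nonneg hε.1.le _),
    Real.norm_of_nonneg (Real.rpow_nonneg hε.1.le _)]
  exact Real.rpow_le_rpow_of_exponent_ge hε.1 hε.2.le h

lemma tendsto_rpow_nhdsGT_zero {a : ℝ} (h : 0 < a) :
    Tendsto (fun ε : ℝ => ε ^ a) (𝓝[>] 0) (𝓝 0) := by
  have := (Real.continuousAt_rpow_const 0 a (Or.inr h.le)).tendsto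
  rw [Real.zero_rpow h.ne'] at this
  exact this.mono_left nhdsWithin_le_nhds

lemma flux_isBigO {S : Type*} {P : ℝ → Matrix S S ℝ} {π : ℝ → S → ℝ} {α Φ : S → ℝ}
    (hu : ∀ z z', z ≠ z' → (fun ε => P ε z z') =O[𝓝[>] 0]
      fun ε => ε ^ (α z + max (Φ z' - Φ z) 0)) {y w : S} (hyw : y ≠ w) :
    (fun ε => π ε y * P ε y w) =O[𝓝[>] 0]
      fun ε => (ε ^ α y * π ε y) * ε ^ max (Φ w - Φ y) 0 := by
  refine ((isBigO_refl (fun ε => π ε y) _).mul (hu y w hyw)).trans_eventuallyEq ?_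
  filter_upwards [self_mem_nhdsWithin] with ε hε
  rw [Real.rpow_add hε]; ring

variable {S : Type*} [Fintype S] [DecidableEq S]

/-- In equilibrium, the probability flux out of a set equals the flux into it. -/
lemma flux_balance {P : Matrix S S ℝ} (hP : P ∈ rowStochastic ℝ S) {π : S → ℝ}
    (hπ : π ᵥ* P = π) (B : Finset S) :
    ∑ y ∈ B, ∑ w ∈ Bᶜ, π y * P y w = ∑ y ∈ Bᶜ, ∑ w ∈ B, π y * P y w := by
  -- Both fluxes equal the mass of `B` minus the flux inside `B`: by the row sums here, by
  -- stationarity in `h2`.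
  have h1 : ∑ y ∈ B, π y = ∑ y ∈ B, ∑ w ∈ B, π y * P y w + ∑ y ∈ B, ∑ w ∈ Bᶜ, π y * P y w := by
    rw [← Finset.sum_add_distrib]
    refine Finset.sum_congr rfl fun y _ => ?_
    rw [Finset.sum_add_sum_compl, ← Finset.mul_sum, sum_row_of_mem_rowStochastic hP, mul_one]
  have h2 : ∑ w ∈ B, π w = ∑ y ∈ B, ∑ w ∈ B, π y * P y w + ∑ y ∈ Bᶜ, ∑ w ∈ B, π y * P y w := by
    rw [Finset.sum_add_sum_compl, Finset.sum_comm]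
    refine Finset.sum_congr rfl fun w _ => ?_
    exact (congrFun hπ w).symm
  linarith

/-- A family of stationary distributions of a family of stochastic matrices. -/
structure IsStationaryFamily (P : ℝ → Matrix S S ℝ) (π : ℝ → S → ℝ) : Prop where
  mem_rowStochastic : ∀ᶠ ε in 𝓝[>] (0 : ℝ), P ε ∈ rowStochastic ℝ S
  mem_stdSimplex : ∀ᶠ ε in 𝓝[>] (0 : ℝ), π ε ∈ stdSimplex ℝ S
  vecMul_eq : ∀ᶠ ε in 𝓝[>] (0 : ℝ), π ε ᵥ* P ε = π ε

variable {P : ℝ → Matrix S S ℝ} {π : ℝ → S → ℝ}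

/-- A transition leaving a set is dominated by any bound for the transitions into the set. -/
lemma IsStationaryFamily.isBigO_of_flux (h : IsStationaryFamily P π) {B : Finset S} {z z' : S}
    (hz : z ∈ B) (hz' : z' ∉ B) {f g : ℝ → ℝ}
    (hf : f =O[𝓝[>] 0] fun ε => P ε z z')
    (hg : ∀ y ∉ B, ∀ w ∈ B, (fun ε => π ε y * P ε y w) =O[𝓝[>] 0] g) :
    (fun ε => π ε z * f ε) =O[𝓝[>] 0] g := by
  have h1 : (fun ε => π ε z * P ε z z') =O[𝓝[>] 0]
      fun ε => ∑ y ∈ Bᶜ, ∑ w ∈ B, π ε y * P ε y w := by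
    refine IsBigO.of_bound 1 ?_
    filter_upwards [h.mem_rowStochastic, h.mem_stdSimplex, h.vecMul_eq] with ε hP hS hE
    have hnn : ∀ y w, 0 ≤ π ε y * P ε y w := fun y w =>
      mul_nonneg (hS.1 y) (nonneg_of_mem_rowStochastic hP)
    rw [← flux_balance hP hE B, one_mul, Real.norm_of_nonneg (hnn _ _), Real.norm_of_nonneg
      (Finset.sum_nonneg fun _ _ => Finset.sum_nonneg fun _ _ => hnn _ _)]
    refine le_trans ?_ (Finset.single_le_sum (f := fun y => ∑ w ∈ Bᶜ, π ε y * P ε y w)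
      (fun _ _ => Finset.sum_nonneg fun _ _ => hnn _ _) hz)
    exact Finset.single_le_sum (f := fun w => π ε z * P ε z w) (fun _ _ => hnn _ _)
      (Finset.mem_compl.2 hz')
  have h2 : (fun ε => ∑ y ∈ Bᶜ, ∑ w ∈ B, π ε y * P ε y w) =O[𝓝[>] 0] g :=
    IsBigO.fun_sum fun y hy => IsBigO.fun_sum fun w hw => hg y (Finset.mem_compl.1 hy) w hw
  exact (((isBigO_refl (fun ε => π ε z) _).mul hf).trans h1).trans h2

variable {α Φ : S → ℝ} {d : S}

/-- Flux out of a single state. -/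
lemma IsStationaryFamily.isBigO_of_isBigO (h : IsStationaryFamily P π)
    (hu : ∀ z z', z ≠ z' → (fun ε => P ε z z') =O[𝓝[>] 0]
      fun ε => ε ^ (α z + max (Φ z' - Φ z) 0)) {z z' : S} (hzz' : z ≠ z') {f : ℝ → ℝ}
    (hf : f =O[𝓝[>] 0] fun ε => P ε z z') :
    (fun ε => π ε z * f ε) =O[𝓝[>] 0] fun ε => ε ^ α z' * π ε z' := by
  -- Across the complement of `z'`, the flux back in is exactly what leaves `z'`, at rate at most of
  -- order `ε ^ α z'`.
  refine h.isBigO_of_flux (B := {z'}ᶜ) (by simpa using hzz') (by simp) hf fun y hy w hw => ?_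
  obtain rfl : y = z' := by simpa using hy
  have hyw : y ≠ w := by rintro rfl; simp at hw
  refine (flux_isBigO hu hyw).trans ?_
  simpa using (isBigO_refl (fun ε => ε ^ α y * π ε y) (𝓝[>] 0)).mul
    (isBigO_rpow_of_le (le_max_right (Φ w - Φ y) 0))

/-- Upper bounds for the stationary distribution. A state `z` is left at rate `ε ^ α z`, every
state leads to `d` at no additional cost, and raising the potential `Φ` has a cost. -/
theorem IsStationaryFamily.isBigO_potential (h : IsStationaryFamily P π)
    (hu : ∀ z z', z ≠ z' → (fun ε => P ε z z') =O[𝓝[>] 0]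
      fun ε => ε ^ (α z + max (Φ z' - Φ z) 0))
    (hl : ∀ z, ReflTransGen (fun z z' => (fun ε => ε ^ α z) =O[𝓝[>] 0] fun ε => P ε z z') z d)
    (hαd : α d = 0) (hΦd : Φ d = 0) (hΦ : ∀ z, 0 ≤ Φ z) (z : S) :
    (fun ε => ε ^ α z * π ε z) =O[𝓝[>] 0] fun ε => ε ^ Φ z * π ε d := by
  -- The bound without the gain `ε ^ Φ z`, transported backwards along a path to `d`.
  have hbase : ∀ z, (fun ε => ε ^ α z * π ε z) =O[𝓝[>] 0] fun ε => π ε d := by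
    intro z
    induction hl z using ReflTransGen.head_induction_on with
    | refl => simpa [hαd] using isBigO_refl (fun ε => π ε d) (𝓝[>] 0)
    | @head a b hab _ ih =>
      by_cases hne : a = b
      · rw [hne]; exact ih
      · refine IsBigO.trans ?_ ih
        simpa only [mul_comm] using h.isBigO_of_isBigO hu hne hab
  have hwf : WellFounded fun x y : S => Φ x < Φ y :=
    Finite.wellFounded_of_trans_of_irrefl (r := InvImage (· < ·) Φ)
  induction z using hwf.induction with
  | _ z IH =>
  rcases (hΦ z).eq_or_lt with hz0 | hz0
  · simpa [← hz0] using hbase z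
  -- The superlevel set of `z`. Entering it from a lower state costs the potential difference, which
  -- the induction hypothesis completes to `ε ^ Φ z`.
  set B : Finset S := Finset.univ.filter fun w => Φ z ≤ Φ w
  have hB : ∀ w, w ∈ B ↔ Φ z ≤ Φ w := by simp [B]
  have hflux : ∀ y ∉ B, ∀ w ∈ B, (fun ε => π ε y * P ε y w) =O[𝓝[>] 0]
      fun ε => ε ^ Φ z * π ε d := by
    intro y hy w hw
    rw [hB, not_le] at hy
    rw [hB] at hw
    have hyw : y ≠ w := by rintro rfl; linarith
    refine ((flux_isBigO hu hyw).trans ((IH y hy).mul (isBigO_refl _ _))).trans ?_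
    have e : (fun ε => ε ^ Φ y * π ε d * ε ^ max (Φ w - Φ y) 0) =ᶠ[𝓝[>] 0]
        fun ε => ε ^ Φ w * π ε d := by
      filter_upwards [self_mem_nhdsWithin] with ε hε
      rw [max_eq_left (by linarith), mul_right_comm, ← Real.rpow_add hε, add_sub_cancel]
    exact e.trans_isBigO ((isBigO_rpow_of_le hw).mul (isBigO_refl _ _))
  -- A path to `d` must leave `B`, because `Φ d = 0 < Φ z`. The exit is controlled by the flux into
  -- `B`, and the earlier transitions by balance at single states.
  have hBz : ∀ w, w ∈ B → (fun ε => ε ^ α w * π ε w) =O[𝓝[>] 0]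
      fun ε => ε ^ Φ z * π ε d := by
    intro w
    induction hl w using ReflTransGen.head_induction_on with
    | refl => intro hd; rw [hB, hΦd] at hd; linarith
    | @head a b hab _ ih =>
      intro ha
      by_cases hb : b ∈ B
      · by_cases hne : a = b
        · rw [hne]; exact ih hb
        · refine IsBigO.trans ?_ (ih hb)
          simpa only [mul_comm] using h.isBigO_of_isBigO hu hne hab
      · simpa only [mul_comm] using h.isBigO_of_flux ha hb hab hflux
  exact hBz z ((hB z).2 le_rfl)

lemma IsStationaryFamily.tendsto_zero_of_isBigO_rpow (h : IsStationaryFamily P π) {z x : S}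
    {r : ℝ} (hr : 0 < r)
    (hO : (fun ε => π ε z) =O[𝓝[>] 0] fun ε => ε ^ r * π ε x) :
    Tendsto (fun ε => π ε z) (𝓝[>] 0) (𝓝 0) := by
  refine (hO.trans ?_).trans_tendsto (tendsto_rpow_nhdsGT_zero hr)
  refine IsBigO.of_bound 1 ?_
  filter_upwards [h.mem_stdSimplex, self_mem_nhdsWithin] with ε hS hε
  have hx1 : π ε x ≤ 1 := by
    rw [← hS.2]
    exact Finset.single_le_sum (fun y _ => hS.1 y) (Finset.mem_univ x)
  have h0 : 0 ≤ ε ^ r := Real.rpow_nonneg (le_of_lt hε) _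
  rw [one_mul, Real.norm_of_nonneg h0, Real.norm_of_nonneg (mul_nonneg h0 (hS.1 x))]
  exact mul_le_of_le_one_right h0 hx1

/-- The states that keep their weight in the stationary distribution as `ε → 0` are the states
of minimal potential among the states of `T`, which are left at rate `ε`. -/
theorem IsStationaryFamily.tendsto_one_iff (h : IsStationaryFamily P π) {T : Set S}
    (hT : T.Nonempty)
    (hα1 : ∀ x ∈ T, α x = 1) (hα0 : ∀ x ∉ T, α x = 0) (hd : d ∉ T)
    (hΦd : Φ d = 0) (hΦ : ∀ z, 0 ≤ Φ z) (hΦ1 : ∀ x ∈ T, Φ x < 1)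
    (hu : ∀ z z', z ≠ z' → (fun ε => P ε z z') =O[𝓝[>] 0]
      fun ε => ε ^ (α z + max (Φ z' - Φ z) 0))
    (hl : ∀ z, ReflTransGen (fun z z' => (fun ε => ε ^ α z) =O[𝓝[>] 0] fun ε => P ε z z') z d)
    (hdT : ∀ x ∈ T, (fun ε => ε ^ Φ x) =O[𝓝[>] 0] fun ε => P ε d x) (V : Set S) :
    Tendsto (fun ε => ∑ y, V.indicator (π ε) y) (𝓝[>] 0) (𝓝 1) ↔
      {x | x ∈ T ∧ ∀ y ∈ T, Φ x ≤ Φ y} ⊆ V := by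
  have hup := h.isBigO_potential hu hl (hα0 d hd) hΦd hΦ
  -- Balance at `x`: an inflow of order at least `ε ^ Φ x * π ε d` against an outflow of order at
  -- most `ε * π ε x`.
  have hdx : ∀ x ∈ T, (fun ε => π ε d) =O[𝓝[>] 0] fun ε => ε ^ (1 - Φ x) * π ε x := by
    intro x hx
    have hdx : d ≠ x := by rintro rfl; exact hd hx
    have h1 := (isBigO_refl (fun ε : ℝ => ε ^ (-Φ x)) (𝓝[>] 0)).mul
      (h.isBigO_of_isBigO hu hdx (hdT x hx))
    refine (EventuallyEq.trans_isBigO ?_ h1).trans_eventuallyEq ?_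
    · filter_upwards [self_mem_nhdsWithin] with ε hε
      rw [mul_left_comm, ← Real.rpow_add hε, neg_add_cancel, Real.rpow_zero, mul_one]
    · filter_upwards [self_mem_nhdsWithin] with ε hε
      rw [hα1 x hx, ← mul_assoc, ← Real.rpow_add hε, neg_add_eq_sub]
  have hxy : ∀ x ∈ T, ∀ y ∈ T, (fun ε => π ε y) =O[𝓝[>] 0]
      fun ε => ε ^ (Φ y - Φ x) * π ε x := by
    intro x hx y hy
    have h1 := (isBigO_refl (fun ε : ℝ => ε ^ (-1 : ℝ)) (𝓝[>] 0)).mul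
      ((hup y).trans ((isBigO_refl (fun ε : ℝ => ε ^ Φ y) (𝓝[>] 0)).mul (hdx x hx)))
    refine (EventuallyEq.trans_isBigO ?_ h1).trans_eventuallyEq ?_
    · filter_upwards [self_mem_nhdsWithin] with ε hε
      rw [hα1 y hy, ← mul_assoc, ← Real.rpow_add hε, neg_add_cancel, Real.rpow_zero, one_mul]
    · filter_upwards [self_mem_nhdsWithin] with ε hε
      rw [← mul_assoc, ← mul_assoc, ← Real.rpow_add hε, ← Real.rpow_add hε]
      ring_nf
  obtain ⟨x₀, hx₀T, hx₀⟩ := Set.exists_min_image T Φ T.toFinite hT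
  have hzero : ∀ z, z ∉ {x | x ∈ T ∧ ∀ y ∈ T, Φ x ≤ Φ y} →
      Tendsto (fun ε => π ε z) (𝓝[>] 0) (𝓝 0) := by
    intro z hz
    by_cases hzT : z ∈ T
    · have hlt : Φ x₀ < Φ z := by
        by_contra hle
        exact hz ⟨hzT, fun y hy => (not_lt.1 hle).trans (hx₀ y hy)⟩
      exact h.tendsto_zero_of_isBigO_rpow (sub_pos.2 hlt) (hxy x₀ hx₀T z hzT)
    · refine h.tendsto_zero_of_isBigO_rpow (sub_pos.2 (hΦ1 x₀ hx₀T))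
        (IsBigO.trans ?_ (hdx x₀ hx₀T))
      have h1 : (fun ε => ε ^ Φ z * π ε d) =O[𝓝[>] 0] fun ε => π ε d := by
        simpa using (isBigO_rpow_of_le (hΦ z)).mul (isBigO_refl (fun ε => π ε d) (𝓝[>] 0))
      simpa [hα0 z hzT] using (hup z).trans h1
  -- Minimizers have comparable weights, so if one vanished all states would vanish, against total
  -- mass one.
  have hpos : ∀ x, x ∈ {x | x ∈ T ∧ ∀ y ∈ T, Φ x ≤ Φ y} →
      ¬ Tendsto (fun ε => π ε x) (𝓝[>] 0) (𝓝 0) := by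
    rintro x ⟨hxT, hx⟩ h0
    have hall : ∀ z, Tendsto (fun ε => π ε z) (𝓝[>] 0) (𝓝 0) := by
      intro z
      by_cases hz : z ∈ {x | x ∈ T ∧ ∀ y ∈ T, Φ x ≤ Φ y}
      · have := hxy x hxT z hz.1
        rw [le_antisymm (hz.2 x hxT) (hx z hz.1)] at this
        simp only [sub_self, Real.rpow_zero, one_mul] at this
        exact this.trans_tendsto h0
      · exact hzero z hz
    have hs := tendsto_finsetSum Finset.univ fun z _ => hall z
    have h1 : Tendsto (fun ε => ∑ z, π ε z) (𝓝[>] 0) (𝓝 1) := by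
      refine tendsto_const_nhds.congr' ?_
      filter_upwards [h.mem_stdSimplex] with ε hS using hS.2.symm
    have := tendsto_nhds_unique hs h1
    simp at this
  have hcompl : ∀ᶠ ε in 𝓝[>] (0 : ℝ),
      ∑ y, V.indicator (π ε) y + ∑ y, Vᶜ.indicator (π ε) y = 1 := by
    filter_upwards [h.mem_stdSimplex] with ε hS
    rw [← Finset.sum_add_distrib, ← hS.2]
    exact Finset.sum_congr rfl fun y _ => Set.indicator_self_add_compl_apply V (π ε) y
  constructor
  · intro hV x hx
    by_contra hxV
    refine hpos x hx ?_
    have h1 : Tendsto (fun ε => ∑ y, Vᶜ.indicator (π ε) y) (𝓝[>] 0) (𝓝 0) := by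
      have := (tendsto_const_nhds (x := (1 : ℝ))).sub hV
      rw [sub_self] at this
      refine this.congr' ?_
      filter_upwards [hcompl] with ε hε
      linarith
    refine squeeze_zero' ?_ ?_ h1
    · filter_upwards [h.mem_stdSimplex] with ε hS using hS.1 x
    · filter_upwards [h.mem_stdSimplex] with ε hS
      refine le_trans ?_ (Finset.single_le_sum (f := fun y => Vᶜ.indicator (π ε) y)
        (fun y _ => Set.indicator_nonneg (fun y _ => hS.1 y) y) (Finset.mem_univ x))
      rw [Set.indicator_of_mem (show x ∈ Vᶜ from hxV)]
  · intro hV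
    have h1 : Tendsto (fun ε => ∑ y, Vᶜ.indicator (π ε) y) (𝓝[>] 0) (𝓝 0) := by
      rw [← Finset.sum_const_zero (s := (Finset.univ : Finset S)) (M := ℝ)]
      refine tendsto_finsetSum _ fun y _ => ?_
      by_cases hy : y ∈ V
      · simp [hy]
      · simpa [hy] using hzero y fun hy' => hy (hV hy')
    have := (tendsto_const_nhds (x := (1 : ℝ))).sub h1
    rw [sub_zero] at this
    refine this.congr' ?_
    filter_upwards [hcompl] with ε hε
    linarith

/-- The stochastically stable set, from the limit behaviour of the stationary distributions. -/
lemma isStochasticallyStableSet_of_forall [Nonempty S] {W : Set S}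
    (hlim : ∀ᶠ ε in 𝓝[>] (0 : ℝ), ∀ p ∈ stdSimplex ℝ S,
      Tendsto (fun k : ℕ => p ᵥ* P ε ^ k) atTop (𝓝 (π ε)))
    (hW : ∀ V : Set S,
      Tendsto (fun ε => ∑ y, V.indicator (π ε) y) (𝓝[>] 0) (𝓝 1) ↔ W ⊆ V) :
    IsStochasticallyStableSet P W := by
  have key : ∀ V : Set S, ∀ p ∈ stdSimplex ℝ S,
      (fun ε : ℝ => liminf (fun k : ℕ => probAt (P ε) p V k) atTop) =ᶠ[𝓝[>] 0]
        fun ε => ∑ y, V.indicator (π ε) y := by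
    intro V p hp
    filter_upwards [hlim] with ε hε
    refine Tendsto.liminf_eq ?_
    unfold probAt
    refine tendsto_finsetSum _ fun y _ => ?_
    by_cases hy : y ∈ V
    · simp only [hy, if_true, Set.indicator_of_mem]
      convert tendsto_pi_nhds.1 (hε p hp) y
    · simp [hy]
  constructor
  · intro p hp
    exact ((hW W).2 subset_rfl).congr' (key W p hp).symm
  · intro V hV
    obtain ⟨s⟩ := ‹Nonempty S›
    -- For minimality a single initial distribution is enough.
    have hp : Pi.single s 1 ∈ stdSimplex ℝ S := single_mem_stdSimplex ℝ s
    exact (hW V).1 ((hV _ hp).congr' (key V _ hp))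

end Stationary

/-! ### Lower bounds by powers of the perturbation -/

section Dominates

/-- On `(0, 1)` the function `f` is positive, and near `0` it is at least of order `ε ^ r`. -/
def DominatesRpow (f : ℝ → ℝ) (r : ℝ) : Prop :=
  (∀ ε ∈ Set.Ioo (0 : ℝ) 1, 0 < f ε) ∧ (fun ε : ℝ => ε ^ r) =O[𝓝[>] 0] f

namespace DominatesRpow

variable {f g : ℝ → ℝ} {r s : ℝ}

lemma weaken (h : DominatesRpow f r) (hrs : r ≤ s) : DominatesRpow f s :=
  ⟨h.1, (isBigO_rpow_of_le hrs).trans h.2⟩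

lemma mono (h : DominatesRpow f r) (hfg : ∀ ε ∈ Set.Ioo (0 : ℝ) 1, f ε ≤ g ε) :
    DominatesRpow g r := by
  refine ⟨fun ε hε => (h.1 ε hε).trans_le (hfg ε hε), h.2.trans (IsBigO.of_bound 1 ?_)⟩
  filter_upwards [Ioo_mem_nhdsGT (zero_lt_one' ℝ)] with ε hε
  have h1 := h.1 ε hε
  have h2 := hfg ε hε
  rwa [one_mul, Real.norm_of_nonneg h1.le, Real.norm_of_nonneg (h1.le.trans h2)]

lemma mul (hf : DominatesRpow f r) (hg : DominatesRpow g s) :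
    DominatesRpow (fun ε => f ε * g ε) (r + s) := by
  refine ⟨fun ε hε => mul_pos (hf.1 ε hε) (hg.1 ε hε),
    EventuallyEq.trans_isBigO ?_ (hf.2.mul hg.2)⟩
  filter_upwards [self_mem_nhdsWithin] with ε hε
  exact Real.rpow_add hε r s

lemma const {c : ℝ} (hc : 0 < c) : DominatesRpow (fun _ => c) 0 := by
  refine ⟨fun _ _ => hc, ?_⟩
  simp only [Real.rpow_zero]
  exact isBigO_const_const _ hc.ne' _

lemma prod {κ : Type*} (t : Finset κ) {f : κ → ℝ → ℝ} {r : κ → ℝ}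
    (h : ∀ i ∈ t, DominatesRpow (f i) (r i)) :
    DominatesRpow (fun ε => ∏ i ∈ t, f i ε) (∑ i ∈ t, r i) := by
  classical
  induction t using Finset.induction_on with
  | empty => simpa using const one_pos
  | insert i t hi ih =>
    simp only [Finset.prod_insert hi, Finset.sum_insert hi]
    exact (h i (Finset.mem_insert_self _ _)).mul
      (ih fun j hj => h j (Finset.mem_insert_of_mem hj))

lemma rpow (r : ℝ) : DominatesRpow (fun ε => ε ^ r) r :=
  ⟨fun _ hε => Real.rpow_pos_of_pos hε.1 r, isBigO_refl _ _⟩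

lemma one_sub_rpow (hr : 0 < r) : DominatesRpow (fun ε => 1 - ε ^ r) 0 := by
  refine ⟨fun ε hε => sub_pos.2 (Real.rpow_lt_one hε.1.le hε.2 hr), ?_⟩
  simp only [Real.rpow_zero]
  have h : Tendsto (fun ε : ℝ => 1 - ε ^ r) (𝓝[>] 0) (𝓝 1) := by
    simpa using (tendsto_const_nhds (x := (1 : ℝ))).sub (tendsto_rpow_nhdsGT_zero hr)
  have h2 := (h.inv₀ one_ne_zero).isBigO_one ℝ
  refine (h2.mul (isBigO_refl (fun ε : ℝ => 1 - ε ^ r) _)).congr' ?_ ?_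
  · filter_upwards [Ioo_mem_nhdsGT (zero_lt_one' ℝ)] with ε hε
    exact inv_mul_cancel₀ (sub_pos.2 (Real.rpow_lt_one hε.1.le hε.2 hr)).ne'
  · exact Eventually.of_forall fun ε => one_mul _

end DominatesRpow

end Dominates

/-! ### Action and update probabilities of one agent -/

section Policies

variable {ι : Type*} {A : ι → Type*} {U : ι → (∀ i, A i) → ℝ}
  {F : ℝ → ℝ} {G : ℝ → ℝ → ℝ} {c ε : ℝ}

/-- The assumptions on the utilities and the acceptance functions that the analysis of single
transitions uses. -/
structure IsRegular (U : ι → (∀ i, A i) → ℝ) (F : ℝ → ℝ) (G : ℝ → ℝ → ℝ) (c : ℝ) : Prop where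
  utility : ∀ i a, U i a ∈ Set.Icc (0 : ℝ) 1
  F_nonneg : ∀ u ∈ Set.Icc (0 : ℝ) 1, 0 ≤ F u
  F_anti : AntitoneOn F (Set.Icc 0 1)
  G_nonneg : ∀ v u : ℝ, 0 ≤ v → v < u → u ≤ 1 → 0 ≤ G v u
  c_mem : c ∈ Set.Ioo (0 : ℝ) 1

lemma IsRegular.mem_Icc (h : IsRegular U F G c) (u : Utility U) : (u : ℝ) ∈ Set.Icc (0 : ℝ) 1 := by
  obtain ⟨_, ⟨q, rfl⟩⟩ := u
  exact h.utility _ _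

lemma IsRegular.F_coe_nonneg (h : IsRegular U F G c) (u : Utility U) : 0 ≤ F u :=
  h.F_nonneg _ (h.mem_Icc u)

lemma dirac_nonneg {S : Type*} (s t : S) : 0 ≤ dirac s t := by
  unfold dirac; split_ifs <;> norm_num

@[simp] lemma dirac_self {S : Type*} (s : S) : dirac s s = 1 := by simp [dirac]

lemma sum_dirac {S : Type*} [Fintype S] (s : S) : ∑ t, dirac s t = 1 := by
  classical
  simp [dirac]

lemma sum_mix {S : Type*} [Fintype S] (q : ℝ) (s s' : S) : ∑ t, mix q s s' t = 1 := by
  simp [mix, Finset.sum_add_distrib, ← Finset.mul_sum, sum_dirac]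

lemma mix_nonneg {S : Type*} {q : ℝ} (hq : q ∈ Set.Icc (0 : ℝ) 1) (s s' t : S) :
    0 ≤ mix q s s' t :=
  add_nonneg (mul_nonneg hq.1 (dirac_nonneg _ _))
    (mul_nonneg (sub_nonneg.2 hq.2) (dirac_nonneg _ _))

section Action

variable {i : ι} [Fintype (A i)]

lemma actionProb_none (a : A i) :
    actionProb U ε (none : AgentState U i) a = 1 / (Fintype.card (A i) : ℝ) := rfl

open Classical in
lemma actionProb_some (b a : A i) (v : Utility U) :
    actionProb U ε (some (b, v)) a =
      if a = b then 1 - (if (v : ℝ) < 1 ∧ Nontrivial (A i) then ε else 0)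
      else (if (v : ℝ) < 1 ∧ Nontrivial (A i) then ε else 0) / ((Fintype.card (A i) : ℝ) - 1) :=
  rfl

lemma one_le_card_sub_one [Nontrivial (A i)] : (1 : ℝ) ≤ (Fintype.card (A i) : ℝ) - 1 := by
  have h : 1 < Fintype.card (A i) := Fintype.one_lt_card
  have : (2 : ℝ) ≤ Fintype.card (A i) := by exact_mod_cast h
  linarith

lemma actionProb_nonneg (hε : ε ∈ Set.Ioo (0 : ℝ) 1) (s : AgentState U i) (a : A i) :
    0 ≤ actionProb U ε s a := by
  rcases s with _ | ⟨b, v⟩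
  · rw [actionProb_none]; positivity
  · rw [actionProb_some]
    by_cases h : (v : ℝ) < 1 ∧ Nontrivial (A i)
    · have := h.2
      have h1 := one_le_card_sub_one (A := A) (i := i)
      simp only [h, and_self, if_true]
      split_ifs
      · linarith [hε.2]
      · exact div_nonneg hε.1.le (by linarith)
    · simp only [h, if_false]
      split_ifs <;> norm_num

lemma sum_actionProb [Nonempty (A i)] (s : AgentState U i) : ∑ a, actionProb U ε s a = 1 := by
  classical
  rcases s with _ | ⟨b, v⟩
  · simp [actionProb_none]
  · simp only [actionProb_some]
    rw [← Finset.add_sum_erase _ _ (Finset.mem_univ b), if_pos rfl,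
      Finset.sum_congr rfl fun a ha => if_neg (Finset.ne_of_mem_erase ha), Finset.sum_const,
      Finset.card_erase_of_mem (Finset.mem_univ b), Finset.card_univ, nsmul_eq_mul,
      Nat.cast_sub Fintype.card_pos, Nat.cast_one]
    by_cases h : (v : ℝ) < 1 ∧ Nontrivial (A i)
    · have := h.2
      have h1 := one_le_card_sub_one (A := A) (i := i)
      rw [mul_div_cancel₀ _ (by linarith)]; ring
    · simp [h]

lemma actionProb_le_one [Nonempty (A i)] (hε : ε ∈ Set.Ioo (0 : ℝ) 1) (s : AgentState U i)
    (a : A i) : actionProb U ε s a ≤ 1 := by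
  rw [← sum_actionProb (ε := ε) s]
  exact Finset.single_le_sum (fun a _ => actionProb_nonneg hε s a) (Finset.mem_univ a)

lemma actionProb_explore_le (hε : ε ∈ Set.Ioo (0 : ℝ) 1) {b a : A i} (hab : a ≠ b)
    (v : Utility U) : actionProb U ε (some (b, v)) a ≤ ε := by
  have : Nontrivial (A i) := ⟨a, b, hab⟩
  have h1 := one_le_card_sub_one (A := A) (i := i)
  rw [actionProb_some, if_neg hab]
  split_ifs
  · exact div_le_self hε.1.le h1
  · simpa using hε.1.le

lemma actionProb_explore_eq_zero {b a : A i} (hab : a ≠ b) {v : Utility U} (hv : (v : ℝ) = 1) :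
    actionProb U ε (some (b, v)) a = 0 := by
  rw [actionProb_some, if_neg hab]
  simp [hv]

lemma dominatesRpow_actionProb_none [Nonempty (A i)] (a : A i) :
    DominatesRpow (fun ε => actionProb U ε (none : AgentState U i) a) 0 := by
  simp only [actionProb_none]
  exact DominatesRpow.const (by positivity)

lemma dominatesRpow_actionProb_benchmark (b : A i) (v : Utility U) :
    DominatesRpow (fun ε => actionProb U ε (some (b, v)) b) 0 := by
  refine (DominatesRpow.one_sub_rpow one_pos).mono fun ε hε => ?_
  rw [actionProb_some, if_pos rfl, Real.rpow_one]
  have := hε.1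
  split_ifs <;> linarith

lemma dominatesRpow_actionProb_explore {b a : A i} (hab : a ≠ b) {v : Utility U}
    (hv : (v : ℝ) < 1) : DominatesRpow (fun ε => actionProb U ε (some (b, v)) a) 1 := by
  have hA : Nontrivial (A i) := ⟨a, b, hab⟩
  have h1 := one_le_card_sub_one (A := A) (i := i)
  have h2 := (DominatesRpow.rpow 1).mul
    (DominatesRpow.const (c := ((Fintype.card (A i) : ℝ) - 1)⁻¹) (by positivity))
  rw [add_zero] at h2
  refine h2.mono fun ε _ => le_of_eq ?_
  rw [actionProb_some, if_neg hab, if_pos ⟨hv, hA⟩, Real.rpow_one]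
  rfl

end Action

section Update

variable {i : ι}

open Classical in
/-- The state of an agent with benchmark `(b, v)` that plays `b` and observes `u`. -/
def react (b : A i) (v u : Utility U) : AgentState U i :=
  if (v : ℝ) ≤ u then some (b, u) else none

lemma updateProb_none (a : A i) (u : Utility U) :
    updateProb U F G c ε none a u = mix (if 0 < F u then ε ^ F u else c) (some (a, u)) none := by
  funext t
  simp only [updateProb]

lemma updateProb_benchmark (b : A i) (v u : Utility U) :
    updateProb U F G c ε (some (b, v)) b u = dirac (react b v u) := by
  funext t
  simp only [updateProb, react, ne_eq, not_true_eq_false, if_false]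
  rcases lt_trichotomy (v : ℝ) u with h | h | h
  · simp [h, h.le]
  -- Keeping the state and accepting coincide here, which is why `react` needs only two cases.
  · have : v = u := Subtype.ext h
    subst this; simp
  · simp [h.not_gt, h.not_ge, h.ne]

open Classical in
lemma updateProb_explore {b a : A i} (hab : a ≠ b) (v u : Utility U) :
    updateProb U F G c ε (some (b, v)) a u =
      if (v : ℝ) < u then mix (ε ^ G v u) (some (a, u)) (some (b, v)) else dirac (some (b, v)) := by
  funext t
  simp only [updateProb, ne_eq, hab, not_false_eq_true, if_true]

lemma rpow_mem_Icc (hε : ε ∈ Set.Ioo (0 : ℝ) 1) {r : ℝ} (hr : 0 ≤ r) :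
    ε ^ r ∈ Set.Icc (0 : ℝ) 1 :=
  ⟨Real.rpow_nonneg hε.1.le r, Real.rpow_le_one hε.1.le hε.2.le hr⟩

lemma IsRegular.acceptProb_mem (h : IsRegular U F G c) (hε : ε ∈ Set.Ioo (0 : ℝ) 1)
    (u : Utility U) : (if 0 < F u then ε ^ F u else c) ∈ Set.Icc (0 : ℝ) 1 := by
  split_ifs
  · exact rpow_mem_Icc hε (h.F_coe_nonneg u)
  · exact ⟨h.c_mem.1.le, h.c_mem.2.le⟩

lemma IsRegular.G_coe_nonneg (h : IsRegular U F G c) {v u : Utility U} (hvu : (v : ℝ) < u) :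
    0 ≤ G v u :=
  h.G_nonneg v u (h.mem_Icc v).1 hvu (h.mem_Icc u).2

lemma IsRegular.updateProb_nonneg (h : IsRegular U F G c) (hε : ε ∈ Set.Ioo (0 : ℝ) 1)
    (s : AgentState U i) (a : A i) (u : Utility U) (t : AgentState U i) :
    0 ≤ updateProb U F G c ε s a u t := by
  rcases s with _ | ⟨b, v⟩
  · rw [updateProb_none]
    exact mix_nonneg (h.acceptProb_mem hε u) _ _ _
  · rcases eq_or_ne a b with rfl | hab
    · rw [updateProb_benchmark]; exact dirac_nonneg _ _
    · rw [updateProb_explore hab]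
      split_ifs with hvu
      · exact mix_nonneg (rpow_mem_Icc hε (h.G_coe_nonneg hvu)) _ _ _
      · exact dirac_nonneg _ _

lemma sum_updateProb [Fintype (AgentState U i)] (s : AgentState U i) (a : A i) (u : Utility U) :
    ∑ t, updateProb U F G c ε s a u t = 1 := by
  rcases s with _ | ⟨b, v⟩
  · rw [updateProb_none]; exact sum_mix _ _ _
  · rcases eq_or_ne a b with rfl | hab
    · rw [updateProb_benchmark]; exact sum_dirac _
    · rw [updateProb_explore hab]
      split_ifs
      · exact sum_mix _ _ _
      · exact sum_dirac _

/-- The contribution of an agent to the potential. -/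
def agentPotential (F : ℝ → ℝ) (s : AgentState U i) : ℝ := s.elim 0 fun bv => F bv.2

@[simp] lemma agentPotential_none : agentPotential F (none : AgentState U i) = 0 := rfl

@[simp] lemma agentPotential_some (b : A i) (v : Utility U) :
    agentPotential F (some (b, v) : AgentState U i) = F v := rfl

lemma IsRegular.agentPotential_nonneg (h : IsRegular U F G c) (s : AgentState U i) :
    0 ≤ agentPotential F s := by
  rcases s with _ | ⟨b, v⟩
  · exact le_rfl
  · exact h.F_coe_nonneg v

lemma dirac_le_rpow {S : Type*} (hε : ε ∈ Set.Ioo (0 : ℝ) 1) {s t : S} {r : ℝ}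
    (h : t = s → r = 0) : dirac s t ≤ ε ^ r := by
  unfold dirac
  split_ifs with hts
  · rw [h hts, Real.rpow_zero]
  · exact Real.rpow_nonneg hε.1.le _

lemma mix_le_rpow {S : Type*} (hε : ε ∈ Set.Ioo (0 : ℝ) 1) {s s' t : S} {q r : ℝ}
    (hq : q ∈ Set.Icc (0 : ℝ) 1) (hne : s ≠ s') (h : t = s → q ≤ ε ^ r) (h' : t = s' → r = 0) :
    mix q s s' t ≤ ε ^ r := by
  unfold mix dirac
  have h0 := Real.rpow_nonneg hε.1.le r
  split_ifs with h1 h2 h2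
  · exact absurd (h1.symm.trans h2) hne
  · simpa using h h1
  · rw [h' h2, Real.rpow_zero]; linarith [hq.1]
  · simpa using h0

/-- An increase of the potential has a cost. -/
lemma IsRegular.updateProb_le (h : IsRegular U F G c) (hε : ε ∈ Set.Ioo (0 : ℝ) 1)
    (s : AgentState U i) (a : A i) (u : Utility U) (t : AgentState U i) :
    updateProb U F G c ε s a u t ≤ ε ^ max (agentPotential F t - agentPotential F s) 0 := by
  have hFu := h.F_coe_nonneg u
  rcases s with _ | ⟨b, v⟩
  · rw [updateProb_none]
    refine mix_le_rpow hε (h.acceptProb_mem hε u) (by simp) ?_ ?_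
    · rintro rfl
      simp only [agentPotential_some, agentPotential_none, sub_zero, max_eq_left hFu]
      split_ifs with h0
      · exact le_rfl
      · rw [le_antisymm (not_lt.1 h0) hFu, Real.rpow_zero]; exact h.c_mem.2.le
    · rintro rfl; simp
  -- A content agent that stays content never lowers its benchmark utility, so by monotonicity of
  -- `F` its potential does not rise.
  · have hdec : ∀ w : Utility U, (v : ℝ) ≤ w → max (F w - F v) 0 = 0 := fun w hw =>
      max_eq_right (sub_nonpos.2 (h.F_anti (h.mem_Icc v) (h.mem_Icc w) hw))
    rcases eq_or_ne a b with rfl | hab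
    · rw [updateProb_benchmark]
      refine dirac_le_rpow hε ?_
      rintro rfl
      unfold react
      split_ifs with hvu
      · simpa using hdec u hvu
      · simpa using h.F_coe_nonneg v
    · rw [updateProb_explore hab]
      split_ifs with hvu
      · refine mix_le_rpow hε (rpow_mem_Icc hε (h.G_coe_nonneg hvu)) (by simp [hab]) ?_ ?_
        · rintro rfl
          simp only [agentPotential_some]
          rw [hdec u hvu.le, Real.rpow_zero]
          exact (rpow_mem_Icc hε (h.G_coe_nonneg hvu)).2
        · rintro rfl; simp
      · refine dirac_le_rpow hε ?_
        rintro rfl; simp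

lemma IsRegular.dominatesRpow_updateProb_none_none (h : IsRegular U F G c) (a : A i)
    (u : Utility U) : DominatesRpow (fun ε => updateProb U F G c ε none a u none) 0 := by
  have e : ∀ ε, updateProb U F G c ε none a u none = 1 - if 0 < F u then ε ^ F u else c := by
    intro ε
    rw [updateProb_none]
    simp [mix, dirac]
  simp only [e]
  split_ifs with h0
  · exact DominatesRpow.one_sub_rpow h0
  · exact DominatesRpow.const (sub_pos.2 h.c_mem.2)

lemma IsRegular.dominatesRpow_updateProb_none_some (h : IsRegular U F G c) (a : A i)
    (u : Utility U) :
    DominatesRpow (fun ε => updateProb U F G c ε none a u (some (a, u))) (F u) := by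
  have e : ∀ ε, updateProb U F G c ε none a u (some (a, u)) = if 0 < F u then ε ^ F u else c := by
    intro ε
    rw [updateProb_none]
    simp [mix, dirac]
  simp only [e]
  split_ifs with h0
  · exact DominatesRpow.rpow _
  · exact (DominatesRpow.const h.c_mem.1).weaken (h.F_coe_nonneg u)

lemma dominatesRpow_updateProb_react (b : A i) (v u : Utility U) :
    DominatesRpow (fun ε => updateProb U F G c ε (some (b, v)) b u (react b v u)) 0 := by
  simp only [updateProb_benchmark, dirac_self]
  exact DominatesRpow.const one_pos

open Classical in
-- An improving exploration is rejected with probability `1 - ε ^ G v u`, which tends to `1` unless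
-- `G v u = 0`; in that case acceptance is certain. The target state is the outcome of order one.
lemma IsRegular.dominatesRpow_updateProb_explore (h : IsRegular U F G c) {b a : A i}
    (hab : a ≠ b) (v u : Utility U) :
    DominatesRpow (fun ε => updateProb U F G c ε (some (b, v)) a u
      (if (v : ℝ) < u ∧ G v u = 0 then some (a, u) else some (b, v))) 0 := by
  simp only [updateProb_explore hab]
  by_cases hvu : (v : ℝ) < u
  · by_cases hG : G v u = 0
    · simp only [hvu, hG, and_self, if_true, mix, dirac_self, Real.rpow_zero]
      simpa using DominatesRpow.const one_pos
    · have hG' := lt_of_le_of_ne (h.G_coe_nonneg hvu) (Ne.symm hG)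
      simpa [hvu, hG, mix, dirac, hab.symm] using DominatesRpow.one_sub_rpow hG'
  · simpa [hvu] using DominatesRpow.const one_pos

end Update

end Policies

/-! ### Joint states and compatible action profiles -/

section States

variable {ι : Type*} {A : ι → Type*} {U : ι → (∀ i, A i) → ℝ}

open Classical in
/-- The order of the rate at which a state is left: `1` for aligned states, else `0`. -/
def exitCost (x : State U) : ℝ := if IsAligned U x then 1 else 0

lemma exitCost_nonneg (x : State U) : 0 ≤ exitCost x := by
  unfold exitCost; split_ifs <;> norm_num

/-- The state in which all agents are discontent. -/
def discontent (U : ι → (∀ i, A i) → ℝ) : State U := fun _ => none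

/-- The aligned state with a given benchmark profile. -/
def alignedState (U : ι → (∀ i, A i) → ℝ) (a : ∀ i, A i) : State U :=
  fun i => some (a i, obs U i a)

/-- The state reached when the profile `a` is played, the content agents play their benchmarks,
and no discontent agent becomes content. -/
def nextState (x : State U) (a : ∀ i, A i) : State U :=
  fun i => (x i).elim none fun bv => react bv.1 bv.2 (obs U i a)

/-- All content agents have their benchmark action in the profile `a`. -/
def Compatible (x : State U) (a : ∀ i, A i) : Prop :=
  ∀ i b v, x i = some (b, v) → b = a i

lemma Compatible.nextState {x : State U} {a b : ∀ i, A i} (h : Compatible x b) :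
    Compatible (nextState x a) b := by
  intro i b' v hi
  rcases hx : x i with _ | ⟨b₀, v₀⟩
  · simp [IODL.nextState, hx] at hi
  · simp only [IODL.nextState, hx, Option.elim_some, react] at hi
    split_ifs at hi
    · have := h i b₀ v₀ hx
      simp only [Option.some.injEq, Prod.mk.injEq] at hi
      rw [← hi.1, this]

lemma nextState_eq_none {x : State U} {a : ∀ i, A i} {i : ι} (h : x i = none) :
    nextState x a i = none := by
  simp [nextState, h]

/-- If two compatible profiles give different utilities to an agent, it becomes discontent when
the better profile is played first, and then the worse one. -/
lemma nextState_nextState_eq_none {x : State U} {a b : ∀ i, A i} {i : ι}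
    (hab : U i a < U i b) : nextState (nextState x b) a i = none := by
  rcases hi : x i with _ | ⟨b₀, v⟩
  · exact nextState_eq_none (nextState_eq_none hi)
  · by_cases hv : (v : ℝ) ≤ U i b
    · simp [nextState, hi, react, obs, hv, not_le.2 hab]
    · simp [nextState, hi, react, obs, hv]

lemma exists_compatible_profile [∀ i, Nonempty (A i)] (x : State U) :
    ∃ a : ∀ i, A i, Compatible x a := by
  refine ⟨fun i => (x i).elim (Classical.arbitrary _) Prod.fst, fun i b v hi => ?_⟩
  simp [hi]

lemma isAligned_alignedState (a : ∀ i, A i) : IsAligned U (alignedState U a) :=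
  ⟨a, fun _ => rfl⟩

lemma isOptimal_alignedState {a : ∀ i, A i} (ha : ∀ i, U i a = 1) :
    IsOptimal U (alignedState U a) :=
  ⟨isAligned_alignedState a, fun i => ⟨a i, obs U i a, rfl, ha i⟩⟩

end States

/-! ### The potential and the cost of raising it -/

section Potential

variable {ι : Type*} [Fintype ι] {A : ι → Type*}
  {U : ι → (∀ i, A i) → ℝ} {F : ℝ → ℝ} {G : ℝ → ℝ → ℝ} {c ε : ℝ}

/-- The sum of the values of `F` at the benchmark utilities of the content agents. -/
def potential (F : ℝ → ℝ) (x : State U) : ℝ := ∑ i, agentPotential F (x i)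

lemma IsRegular.potential_nonneg (h : IsRegular U F G c) (x : State U) : 0 ≤ potential F x :=
  Finset.sum_nonneg fun i _ => h.agentPotential_nonneg (x i)

lemma IsRegular.prod_updateProb_le (h : IsRegular U F G c) (hε : ε ∈ Set.Ioo (0 : ℝ) 1)
    (x y : State U) (a : ∀ i, A i) :
    ∏ i, updateProb U F G c ε (x i) (a i) (obs U i a) (y i) ≤
      ε ^ max (potential F y - potential F x) 0 := by
  calc ∏ i, updateProb U F G c ε (x i) (a i) (obs U i a) (y i)
      ≤ ∏ i, ε ^ max (agentPotential F (y i) - agentPotential F (x i)) 0 :=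
        Finset.prod_le_prod (fun i _ => h.updateProb_nonneg hε _ _ _ _)
          fun i _ => h.updateProb_le hε _ _ _ _
    _ = ε ^ ∑ i, max (agentPotential F (y i) - agentPotential F (x i)) 0 :=
        (Real.rpow_sum_of_pos hε.1 _ _).symm
    _ ≤ _ := by
        refine Real.rpow_le_rpow_of_exponent_ge hε.1 hε.2.le (max_le ?_ ?_)
        · rw [potential, potential, ← Finset.sum_sub_distrib]
          exact Finset.sum_le_sum fun i _ => le_max_left _ _
        · exact Finset.sum_nonneg fun i _ => le_max_right _ _

/-- When the benchmark profile is played in an aligned state, everybody observes its own benchmark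
utility, so nothing moves. Leaving therefore requires an exploration. -/
lemma prod_updateProb_aligned {x y : State U} {a : ∀ i, A i}
    (hx : ∀ i, x i = some (a i, obs U i a)) (hxy : x ≠ y) :
    ∏ i, updateProb U F G c ε (x i) (a i) (obs U i a) (y i) = 0 := by
  obtain ⟨i, hi⟩ := Function.ne_iff.1 hxy
  refine Finset.prod_eq_zero (Finset.mem_univ i) ?_
  rw [hx, updateProb_benchmark]
  have hreact : react (a i) (obs U i a) (obs U i a) = x i := by simp [react, hx]
  rw [hreact]
  exact if_neg hi.symm

lemma IsRegular.term_nonneg [∀ i, Fintype (A i)] (h : IsRegular U F G c) (hε : ε ∈ Set.Ioo (0 : ℝ) 1) (x y : State U)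
    (a : ∀ i, A i) : 0 ≤ (∏ i, actionProb U ε (x i) (a i)) *
      ∏ i, updateProb U F G c ε (x i) (a i) (obs U i a) (y i) :=
  mul_nonneg (Finset.prod_nonneg fun _ _ => actionProb_nonneg hε _ _)
    (Finset.prod_nonneg fun _ _ => h.updateProb_nonneg hε _ _ _ _)

end Potential

/-! ### Bounds for the transition probabilities -/

section Transition

variable {ι : Type*} [Fintype ι] [DecidableEq ι] {A : ι → Type*} [∀ i, Fintype (A i)]
  {U : ι → (∀ i, A i) → ℝ} {F : ℝ → ℝ} {G : ℝ → ℝ → ℝ} {c ε : ℝ}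

lemma sum_prod_eq_one {κ : ι → Type*} [Fintype (∀ i, κ i)] [∀ i, Fintype (κ i)]
    {f : ∀ i, κ i → ℝ} (h : ∀ i, ∑ t, f i t = 1) : ∑ y : ∀ i, κ i, ∏ i, f i (y i) = 1 := by
  have h1 := Finset.prod_univ_sum (fun i => (Finset.univ : Finset (κ i))) f
  rw [Finset.prod_congr rfl fun i _ => h i, Finset.prod_const_one, Fintype.piFinset_univ] at h1
  rw [h1]
  convert rfl

lemma IsRegular.transition_mem_rowStochastic [∀ i, Nonempty (A i)] [DecidableEq (State U)]
    (h : IsRegular U F G c) (hε : ε ∈ Set.Ioo (0 : ℝ) 1) :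
    transition U F G c ε ∈ rowStochastic ℝ (State U) := by
  rw [mem_rowStochastic_iff_sum]
  refine ⟨fun x y => Finset.sum_nonneg fun a _ => h.term_nonneg hε x y a, fun x => ?_⟩
  have : Fintype (Utility U) := Set.fintypeRange _
  unfold transition
  rw [Finset.sum_comm, ← sum_prod_eq_one fun i => sum_actionProb (ε := ε) (x i)]
  refine Finset.sum_congr rfl fun a _ => ?_
  rw [← Finset.mul_sum, sum_prod_eq_one fun i =>
    sum_updateProb (F := F) (G := G) (c := c) (ε := ε) (x i) (a i) (obs U i a), mul_one]

/-- All terms of the sum over profiles are nonnegative, so one profile gives a lower bound. -/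
lemma IsRegular.dominatesRpow_transition (h : IsRegular U F G c) {x y : State U} (a : ∀ i, A i)
    {r s : ι → ℝ} (hr : ∀ i, DominatesRpow (fun ε => actionProb U ε (x i) (a i)) (r i))
    (hs : ∀ i, DominatesRpow
      (fun ε => updateProb U F G c ε (x i) (a i) (obs U i a) (y i)) (s i)) :
    DominatesRpow (fun ε => transition U F G c ε x y) (∑ i, r i + ∑ i, s i) := by
  refine ((DominatesRpow.prod Finset.univ fun i _ => hr i).mul
    (DominatesRpow.prod Finset.univ fun i _ => hs i)).mono fun ε hε => ?_
  exact Finset.single_le_sum (f := fun a => (∏ i, actionProb U ε (x i) (a i)) *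
      ∏ i, updateProb U F G c ε (x i) (a i) (obs U i a) (y i))
    (fun a _ => h.term_nonneg hε x y a) (Finset.mem_univ a)

/-- Two independent costs multiply: the updates pay for the rise of the potential, and if `x` is
aligned some agent must have explored, which costs a factor `ε`. -/
lemma IsRegular.transition_le [∀ i, Nonempty (A i)] (h : IsRegular U F G c)
    (hε : ε ∈ Set.Ioo (0 : ℝ) 1) {x y : State U} (hxy : x ≠ y) :
    transition U F G c ε x y ≤ (Fintype.card (∀ i, A i) : ℝ) *
      ε ^ (exitCost x + max (potential F y - potential F x) 0) := by
  rw [← nsmul_eq_mul]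
  refine Finset.sum_le_card_nsmul _ _ _ fun a _ => ?_
  rw [Real.rpow_add hε.1]
  have hupd := h.prod_updateProb_le hε x y a
  have hact0 : 0 ≤ ∏ i, actionProb U ε (x i) (a i) :=
    Finset.prod_nonneg fun _ _ => actionProb_nonneg hε _ _
  have hupd0 := Real.rpow_nonneg hε.1.le (max (potential F y - potential F x) 0)
  have hact1 : ∀ i, actionProb U ε (x i) (a i) ≤ 1 := fun i => actionProb_le_one hε _ _
  by_cases hx : IsAligned U x
  · obtain ⟨b, hb⟩ := id hx
    rw [exitCost, if_pos hx, Real.rpow_one]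
    by_cases hab : a = b
    · subst hab
      rw [prod_updateProb_aligned hb hxy, mul_zero]
      exact mul_nonneg hε.1.le hupd0
    · obtain ⟨i, hi⟩ := Function.ne_iff.1 hab
      refine mul_le_mul ?_ hupd (Finset.prod_nonneg fun _ _ => h.updateProb_nonneg hε _ _ _ _)
        hε.1.le
      rw [← Finset.mul_prod_erase _ _ (Finset.mem_univ i)]
      refine (mul_le_of_le_one_right (actionProb_nonneg hε _ _) ?_).trans ?_
      · exact Finset.prod_le_one (fun _ _ => actionProb_nonneg hε _ _) fun j _ => hact1 j
      · rw [hb]; exact actionProb_explore_le hε hi _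
  · rw [exitCost, if_neg hx, Real.rpow_zero]
    exact mul_le_mul (Finset.prod_le_one (fun _ _ => actionProb_nonneg hε _ _) fun j _ => hact1 j)
      hupd (Finset.prod_nonneg fun _ _ => h.updateProb_nonneg hε _ _ _ _) zero_le_one

/-- Optimal states are absorbing. -/
lemma IsRegular.transition_self_of_isOptimal [∀ i, Nonempty (A i)]
    (h : IsRegular U F G c) (hε : ε ∈ Set.Ioo (0 : ℝ) 1) {x : State U} (hx : IsOptimal U x) :
    transition U F G c ε x x = 1 := by
  classical
  have hzero : ∀ y, y ≠ x → transition U F G c ε x y = 0 := by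
    intro y hyx
    obtain ⟨⟨b, hb⟩, h1⟩ := hx
    refine Finset.sum_eq_zero fun a _ => ?_
    by_cases hab : a = b
    · subst hab
      rw [prod_updateProb_aligned hb hyx.symm, mul_zero]
    · obtain ⟨i, hi⟩ := Function.ne_iff.1 hab
      rw [Finset.prod_eq_zero (Finset.mem_univ i), zero_mul]
      obtain ⟨b', v, hv, hv1⟩ := h1 i
      obtain ⟨rfl, rfl⟩ : b' = b i ∧ v = obs U i b := by
        have := hv.symm.trans (hb i); simpa using this
      rw [hv]
      exact actionProb_explore_eq_zero hi hv1
  rw [← sum_row_of_mem_rowStochastic (h.transition_mem_rowStochastic hε) x]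
  exact (Finset.sum_eq_single x (fun y _ hy => hzero y hy) (by simp)).symm

end Transition

/-! ### Accessibility of the discontent state and of the optimal states -/

section Reachability

variable {ι : Type*} [Fintype ι] [DecidableEq ι] {A : ι → Type*} [∀ i, Fintype (A i)]
  {U : ι → (∀ i, A i) → ℝ} {F : ℝ → ℝ} {G : ℝ → ℝ → ℝ} {c : ℝ}

/-- A transition whose probability is positive, and of the maximal order `ε ^ exitCost x`. -/
def Step (U : ι → (∀ i, A i) → ℝ) (F : ℝ → ℝ) (G : ℝ → ℝ → ℝ) (c : ℝ) (x y : State U) : Prop :=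
  DominatesRpow (fun ε => transition U F G c ε x y) (exitCost x)

open Classical in
/-- The state reached from the aligned state with benchmark profile `a` when agent `i` explores,
the profile `b` being played, and agent `i` rejects the new action if it can. -/
def exploreState (U : ι → (∀ i, A i) → ℝ) (G : ℝ → ℝ → ℝ) (a b : ∀ i, A i) (i : ι) : State U :=
  fun k => if k = i then
      (if U k a < U k b ∧ G (U k a) (U k b) = 0 then some (b k, obs U k b)
        else some (a k, obs U k a))
    else react (a k) (obs U k a) (obs U k b)

/-- The only factor that is not of order one is the single exploration, which is what leaving an
aligned state costs anyway. -/
lemma IsRegular.step_exploreState (h : IsRegular U F G c) {a b : ∀ i, A i} {i : ι}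
    (hi : U i a < 1) (hbi : b i ≠ a i) (hb : ∀ k, k ≠ i → b k = a k) :
    Step U F G c (alignedState U a) (exploreState U G a b i) := by
  have := h.dominatesRpow_transition (x := alignedState U a) (y := exploreState U G a b i) b
    (r := fun k => if k = i then 1 else 0) (s := fun _ => 0) (fun k => ?_) (fun k => ?_)
  · rw [Step, exitCost, if_pos (isAligned_alignedState a)]
    simpa using this
  · by_cases hk : k = i
    · subst hk
      rw [if_pos rfl]
      exact dominatesRpow_actionProb_explore hbi hi
    · rw [if_neg hk, hb k hk]
      exact dominatesRpow_actionProb_benchmark _ _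
  · by_cases hk : k = i
    · subst hk
      simp only [exploreState, if_true]
      exact h.dominatesRpow_updateProb_explore hbi _ _
    · simp only [exploreState, hk, if_false, hb k hk]
      exact dominatesRpow_updateProb_react _ _ _

variable [∀ i, Nonempty (A i)]

lemma IsRegular.dominatesRpow_nextState (h : IsRegular U F G c) {x : State U} {a : ∀ i, A i}
    (hx : Compatible x a) :
    DominatesRpow (fun ε => transition U F G c ε x (nextState x a)) 0 := by
  have := h.dominatesRpow_transition (x := x) (y := nextState x a) a (r := fun _ => 0)
    (s := fun _ => 0) (fun i => ?_) (fun i => ?_)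
  · simpa using this
  · rcases hi : x i with _ | ⟨b, v⟩
    · exact dominatesRpow_actionProb_none _
    · obtain rfl := hx i b v hi
      exact dominatesRpow_actionProb_benchmark _ _
  · rcases hi : x i with _ | ⟨b, v⟩
    · rw [nextState_eq_none hi]
      exact h.dominatesRpow_updateProb_none_none _ _
    · obtain rfl := hx i b v hi
      simp only [nextState, hi, Option.elim_some]
      exact dominatesRpow_updateProb_react _ _ _

lemma IsRegular.step_nextState (h : IsRegular U F G c) {x : State U} {a : ∀ i, A i}
    (hx : Compatible x a) : Step U F G c x (nextState x a) :=
  (h.dominatesRpow_nextState hx).weaken (exitCost_nonneg x)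

/-- Discontent spreads. -/
lemma IsRegular.reach_discontent (h : IsRegular U F G c) (hinter : Interdependent U)
    (x : State U) (hx : ∃ i, x i = none) : ReflTransGen (Step U F G c) x (discontent U) := by
  classical
  induction hn : (Finset.univ.filter fun i => x i ≠ none).card using Nat.strong_induction_on
    generalizing x with
  | _ n IH =>
  by_cases hall : ∀ i, x i = none
  · rw [show x = discontent U from funext hall]
  push Not at hall
  obtain ⟨k, hk⟩ := hall
  obtain ⟨a, ha⟩ := exists_compatible_profile x
  -- Discontent agents play any action with probability of order one, so jointly they can alter the
  -- utility of some content agent `i`.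
  obtain ⟨i, hi, b, hb, hne⟩ := hinter a {i | x i = none} hx fun hJ => hk (by
    have : k ∈ {i | x i = none} := hJ ▸ Set.mem_univ k
    exact this)
  have hbc : Compatible x b := by
    intro j b' v hj
    rw [hb j (by simp [hj])]
    exact ha j b' v hj
  -- The better profile first raises the benchmark of `i` (or already disappoints it); the worse one
  -- then makes it discontent. The number of content agents drops.
  have key : ∀ a b : ∀ i, A i, Compatible x a → Compatible x b → U i a < U i b →
      ReflTransGen (Step U F G c) x (discontent U) := by
    intro a b ha hb hlt
    refine ReflTransGen.head (h.step_nextState hb)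
      (ReflTransGen.head (h.step_nextState (Compatible.nextState ha)) ?_)
    obtain ⟨j, hj⟩ := hx
    refine IH _ ?_ _ ⟨j, nextState_eq_none (nextState_eq_none hj)⟩ rfl
    rw [← hn]
    refine Finset.card_lt_card ?_
    rw [Finset.ssubset_iff_of_subset]
    · exact ⟨i, by simpa using hi, by simp [nextState_nextState_eq_none hlt]⟩
    · intro l hl
      simp only [Finset.mem_filter, Finset.mem_univ, true_and] at hl ⊢
      exact fun hl' => hl (nextState_eq_none (nextState_eq_none hl'))
  rcases lt_or_gt_of_ne hne with hlt | hlt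
  · exact key b a hbc ha hlt
  · exact key a b ha hbc hlt

/-- From an aligned state, either an optimal state or the discontent state is accessible. -/
lemma IsRegular.reach_of_aligned (h : IsRegular U F G c) (hinter : Interdependent U)
    (hn : 2 ≤ Fintype.card ι) (a : ∀ i, A i) :
    ReflTransGen (Step U F G c) (alignedState U a) (discontent U) ∨
      ∃ x, IsOptimal U x ∧ ReflTransGen (Step U F G c) (alignedState U a) x := by
  classical
  -- Induction on total utility, from larger to smaller values.
  have hwf : WellFounded fun a b : ∀ i, A i => ∑ i, U i b < ∑ i, U i a :=
    Finite.wellFounded_of_trans_of_irrefl (r := InvImage (· > ·) fun a => ∑ i, U i a)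
  induction a using hwf.induction with
  | _ a IH =>
  by_cases hopt : ∀ i, U i a = 1
  · exact Or.inr ⟨_, isOptimal_alignedState hopt, ReflTransGen.refl⟩
  push Not at hopt
  obtain ⟨i, hi⟩ := hopt
  have hi1 : U i a < 1 := lt_of_le_of_ne (h.utility i a).2 hi
  have : Nontrivial ι := Fintype.one_lt_card_iff_nontrivial.1 hn
  -- Agent `i` alone, which may explore since its utility is below `1`, can affect another agent
  -- `j`.
  obtain ⟨j, hj, b, hb, hne⟩ := hinter a {i} (Set.singleton_nonempty i) fun huniv => by
    obtain ⟨k, hk⟩ := exists_ne i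
    have hmem : k ∈ ({i} : Set ι) := by rw [huniv]; exact Set.mem_univ k
    exact hk hmem
  have hbk : ∀ k, k ≠ i → b k = a k := fun k hk => hb k (by simpa using hk)
  have hji : j ≠ i := by simpa using hj
  have hbi : b i ≠ a i := by
    intro heq
    refine hne (congrArg (U j) (funext fun k => ?_))
    by_cases hk : k = i
    · rw [hk, heq]
    · exact hbk k hk
  have hstep := h.step_exploreState hi1 hbi hbk
  by_cases hnone : ∃ k, exploreState U G a b i k = none
  · exact Or.inl (ReflTransGen.head hstep (h.reach_discontent hinter _ hnone))
  push Not at hnone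
  have hle : ∀ k, k ≠ i → U k a ≤ U k b := by
    intro k hk
    by_contra hlt
    refine hnone k ?_
    simp only [exploreState, hk, if_false, react]
    exact if_neg hlt
  have hval : ∀ k, k ≠ i → exploreState U G a b i k = some (a k, obs U k b) := by
    intro k hk
    simp only [exploreState, hk, if_false, react]
    exact if_pos (hle k hk)
  -- Nobody was disappointed. If `i` must accept, the new state is aligned with larger total
  -- utility. Otherwise `i` returns to its benchmark, and `j`, whose benchmark has risen, becomes
  -- discontent.
  by_cases hacc : U i a < U i b ∧ G (U i a) (U i b) = 0
  · have heq : exploreState U G a b i = alignedState U b := by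
      funext k
      by_cases hk : k = i
      · subst hk
        simp only [exploreState, if_true, alignedState]
        exact if_pos hacc
      · rw [hval k hk, alignedState, hbk k hk]
    rw [heq] at hstep
    have hlt : ∑ k, U k a < ∑ k, U k b := by
      refine Finset.sum_lt_sum (fun k _ => ?_) ⟨i, Finset.mem_univ i, hacc.1⟩
      by_cases hk : k = i
      · rw [hk]; exact hacc.1.le
      · exact hle k hk
    rcases IH b hlt with h1 | ⟨x, hx, h1⟩
    · exact Or.inl (ReflTransGen.head hstep h1)
    · exact Or.inr ⟨x, hx, ReflTransGen.head hstep h1⟩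
  · have hself : exploreState U G a b i i = some (a i, obs U i a) := by
      simp only [exploreState, if_true]
      exact if_neg hacc
    have hcomp : Compatible (exploreState U G a b i) a := by
      intro k b' v hk'
      by_cases hk : k = i
      · subst hk
        rw [hself] at hk'
        simp only [Option.some.injEq, Prod.mk.injEq] at hk'
        exact hk'.1.symm
      · rw [hval k hk] at hk'
        simp only [Option.some.injEq, Prod.mk.injEq] at hk'
        exact hk'.1.symm
    refine Or.inl (ReflTransGen.head hstep (ReflTransGen.head (h.step_nextState hcomp)
      (h.reach_discontent hinter _ ⟨j, ?_⟩)))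
    have hlt : ¬ U j b ≤ U j a := not_le.2 (lt_of_le_of_ne (hle j hji) hne.symm)
    simp only [nextState, hval j hji, Option.elim_some, react]
    exact if_neg hlt

/-- From every state, either an optimal state or the discontent state is accessible. -/
theorem IsRegular.reach (h : IsRegular U F G c) (hinter : Interdependent U)
    (hn : 2 ≤ Fintype.card ι) (x : State U) :
    ReflTransGen (Step U F G c) x (discontent U) ∨
      ∃ y, IsOptimal U y ∧ ReflTransGen (Step U F G c) x y := by
  by_cases hx : ∃ i, x i = none
  · exact Or.inl (h.reach_discontent hinter x hx)
  push Not at hx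
  obtain ⟨a, ha⟩ := exists_compatible_profile x
  -- With everybody content, one round of benchmark play corrects all benchmark utilities or
  -- disappoints somebody.
  have hstep := h.step_nextState ha
  by_cases hnone : ∃ i, nextState x a i = none
  · exact Or.inl (ReflTransGen.head hstep (h.reach_discontent hinter _ hnone))
  push Not at hnone
  have heq : nextState x a = alignedState U a := by
    funext i
    have hni := hnone i
    rcases hi : x i with _ | ⟨b, v⟩
    · exact absurd hi (hx i)
    · obtain rfl := ha i b v hi
      simp only [nextState, hi, Option.elim_some, react, alignedState] at hni ⊢
      split_ifs with hv
      · rfl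
      · simp [hv] at hni
  rw [heq] at hstep
  rcases h.reach_of_aligned hinter hn a with h1 | ⟨y, hy, h1⟩
  · exact Or.inl (ReflTransGen.head hstep h1)
  · exact Or.inr ⟨y, hy, ReflTransGen.head hstep h1⟩

/-- All agents may become content at once. -/
lemma IsRegular.dominatesRpow_discontent_aligned (h : IsRegular U F G c) {x : State U}
    (hx : IsAligned U x) :
    DominatesRpow (fun ε => transition U F G c ε (discontent U) x) (potential F x) := by
  obtain ⟨a, ha⟩ := hx
  have := h.dominatesRpow_transition (x := discontent U) (y := x) a (r := fun _ => 0)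
    (s := fun i => F (obs U i a)) (fun i => dominatesRpow_actionProb_none _) (fun i => by
      rw [ha i]; exact h.dominatesRpow_updateProb_none_some _ _)
  simpa [potential, ha] using this

end Reachability

/-! ### The two convergence statements for the learning process -/

section Convergence

variable {ι : Type*} [Fintype ι] [DecidableEq ι] {A : ι → Type*} [∀ i, Fintype (A i)]
  {U : ι → (∀ i, A i) → ℝ} {F : ℝ → ℝ} {G : ℝ → ℝ → ℝ} {c : ℝ}

lemma Step.reflTransGen_pos {ε : ℝ} (hε : ε ∈ Set.Ioo (0 : ℝ) 1) {x y : State U}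
    (h : ReflTransGen (Step U F G c) x y) :
    ReflTransGen (fun x y => 0 < transition U F G c ε x y) x y :=
  h.lift id fun _ _ hab => hab.1 ε hε

variable [∀ i, Nonempty (A i)]

/-- Almost sure convergence to an optimal state. -/
theorem IsRegular.ae_eventually_optimal (h : IsRegular U F G c) (hinter : Interdependent U)
    (hn : 2 ≤ Fintype.card ι) (hopt : ∃ x, IsOptimal U x) {ε : ℝ} (hε : ε ∈ Set.Ioo (0 : ℝ) 1)
    {Ω : Type*} [MeasurableSpace Ω] {μ : Measure Ω} [IsProbabilityMeasure μ] {X : ℕ → Ω → State U}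
    (hX : IsMarkovChain (transition U F G c ε) μ X) :
    ∀ᵐ ω ∂μ, ∃ x, IsOptimal U x ∧ ∀ᶠ k in atTop, X k ω = x := by
  classical
  refine hX.ae_eventually_eq (h.transition_mem_rowStochastic hε) (T := {x | IsOptimal U x})
    (fun x hx => h.transition_self_of_isOptimal hε hx) fun z => ?_
  rcases h.reach hinter hn z with h1 | ⟨y, hy, h1⟩
  · obtain ⟨x, hx⟩ := hopt
    exact ⟨x, hx, (Step.reflTransGen_pos hε h1).tail
      ((h.dominatesRpow_discontent_aligned hx.1).1 ε hε)⟩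
  · exact ⟨y, hy, Step.reflTransGen_pos hε h1⟩

/-- The stochastically stable states are the aligned states of least potential. -/
theorem IsRegular.isStochasticallyStableSet (h : IsRegular U F G c) (hinter : Interdependent U)
    (hn : 2 ≤ Fintype.card ι) (hF : ∀ u ∈ Set.Icc (0 : ℝ) 1, F u < 1 / (Fintype.card ι : ℝ))
    (hopt : ¬ ∃ x, IsOptimal U x) :
    IsStochasticallyStableSet (transition U F G c)
      {x | IsAligned U x ∧ ∀ y, IsAligned U y → potential F x ≤ potential F y} := by
  classical
  have hι : Nonempty ι := Fintype.card_pos_iff.1 (by omega)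
  have hreach : ∀ z, ReflTransGen (Step U F G c) z (discontent U) := fun z =>
    (h.reach hinter hn z).resolve_right fun ⟨y, hy, _⟩ => hopt ⟨y, hy⟩
  have hIoo : ∀ᶠ ε in 𝓝[>] (0 : ℝ), ε ∈ Set.Ioo (0 : ℝ) 1 := Ioo_mem_nhdsGT zero_lt_one
  have hself : ∀ ε ∈ Set.Ioo (0 : ℝ) 1,
      0 < transition U F G c ε (discontent U) (discontent U) := by
    intro ε hε
    have a : ∀ i, A i := fun i => Classical.arbitrary _
    exact (h.dominatesRpow_nextState (x := discontent U) (a := a)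
      (fun i b v hi => by simp [discontent] at hi)).1 ε hε
  have hex : ∀ ε : ℝ, ∃ π : State U → ℝ, ε ∈ Set.Ioo (0 : ℝ) 1 →
      π ∈ stdSimplex ℝ (State U) ∧ π ᵥ* transition U F G c ε = π ∧
        ∀ p ∈ stdSimplex ℝ (State U),
          Tendsto (fun k : ℕ => p ᵥ* transition U F G c ε ^ k) atTop (𝓝 π) := by
    intro ε
    by_cases hε : ε ∈ Set.Ioo (0 : ℝ) 1
    · obtain ⟨π, hπ, hπ', hlim⟩ := exists_tendsto_vecMul_pow (h.transition_mem_rowStochastic hε)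
        (hself ε hε) fun z => Step.reflTransGen_pos hε (hreach z)
      exact ⟨π, fun _ => ⟨hπ, hπ', hlim⟩⟩
    -- A junk value: only small positive `ε` matter.
    · exact ⟨0, fun hε' => absurd hε' hε⟩
  choose π hπ using hex
  have hstat : IsStationaryFamily (transition U F G c) π :=
    ⟨hIoo.mono fun ε hε => h.transition_mem_rowStochastic hε, hIoo.mono fun ε hε => (hπ ε hε).1,
      hIoo.mono fun ε hε => (hπ ε hε).2.1⟩
  have : Nonempty (State U) := ⟨discontent U⟩
  refine isStochasticallyStableSet_of_forall (hIoo.mono fun ε hε => (hπ ε hε).2.2) fun V => ?_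
  refine hstat.tendsto_one_iff (T := {x | IsAligned U x}) (α := exitCost) (Φ := potential F)
    (d := discontent U) ?_ ?_ ?_ ?_ ?_ h.potential_nonneg ?_ ?_ ?_ ?_ V
  · exact ⟨_, isAligned_alignedState fun i => Classical.arbitrary (A i)⟩
  · exact fun x hx => if_pos hx
  · exact fun x hx => if_neg hx
  · rintro ⟨a, ha⟩
    obtain ⟨i⟩ := hι
    simpa [discontent] using ha i
  · simp [potential, discontent]
  · rintro x ⟨a, ha⟩
    -- The bound `1 / n` on `F` enters only here: aligned states have potential below `1`, hence
    -- outweigh the discontent state.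
    calc potential F x = ∑ i, F (U i a) := Finset.sum_congr rfl fun i _ => by rw [ha i]; rfl
      _ < ∑ _i : ι, 1 / (Fintype.card ι : ℝ) :=
        Finset.sum_lt_sum_of_nonempty Finset.univ_nonempty fun i _ => hF _ (h.utility i a)
      _ = 1 := by simp
  · intro z z' hzz'
    refine IsBigO.of_bound (Fintype.card (∀ i, A i) : ℝ) ?_
    filter_upwards [hIoo] with ε hε
    rw [Real.norm_of_nonneg (Real.rpow_nonneg hε.1.le _), Real.norm_of_nonneg
      (nonneg_of_mem_rowStochastic (h.transition_mem_rowStochastic hε))]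
    exact h.transition_le hε hzz'
  · exact fun z => (hreach z).lift id fun _ _ hab => hab.2
  · exact fun x hx => (h.dominatesRpow_discontent_aligned hx).2

end Convergence

end IODL

end

theorem mainTheorem6 {ι : Type*} [Fintype ι] [DecidableEq ι] (hn : 2 ≤ Fintype.card ι)
    {A : ι → Type*} [∀ i, Fintype (A i)] [∀ i, Nonempty (A i)]
    (U : ι → (∀ i, A i) → ℝ) (hU : ∀ i a, U i a ∈ Set.Icc (0 : ℝ) 1)
    (hinter : IODL.Interdependent U)
    (F : ℝ → ℝ) (hFanti : AntitoneOn F (Set.Icc 0 1))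
    (hF : ∀ u ∈ Set.Icc (0 : ℝ) 1, 0 ≤ F u ∧ F u < 1 / (Fintype.card ι : ℝ))
    (G : ℝ → ℝ → ℝ)
    (hG : ∀ v u : ℝ, 0 ≤ v → v < u → u ≤ 1 → 0 ≤ G v u)
    (hGmono : ∀ v v' u : ℝ, 0 ≤ v → v ≤ v' → v' < u → u ≤ 1 → G v u ≤ G v' u)
    (hGanti : ∀ v u u' : ℝ, 0 ≤ v → v < u → u ≤ u' → u' ≤ 1 → G v u' ≤ G v u)
    (c : ℝ) (hc : c ∈ Set.Ioo (0 : ℝ) 1) :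
    ((∃ x, IODL.IsOptimal U x) →
      ∀ ε ∈ Set.Ioo (0 : ℝ) 1,
        ∀ (Ω : Type*) [MeasurableSpace Ω] (μ : Measure Ω) [IsProbabilityMeasure μ]
          (X : ℕ → Ω → IODL.State U),
          IODL.IsMarkovChain (IODL.transition U F G c ε) μ X →
            ∀ᵐ ω ∂μ, ∃ x, IODL.IsOptimal U x ∧ ∀ᶠ k in atTop, X k ω = x) ∧
    ((¬ ∃ x, IODL.IsOptimal U x) →
      IODL.IsStochasticallyStableSet (IODL.transition U F G c)
        {x | IODL.IsAligned U x ∧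
          ∀ y, IODL.IsAligned U y →
            IODL.virtualWelfare U F y ≤ IODL.virtualWelfare U F x}) := by
  have h : IODL.IsRegular U F G c := ⟨hU, fun u hu => (hF u hu).1, hFanti, hG, hc⟩
  refine ⟨fun hopt ε hε Ω _ μ _ X hX => h.ae_eventually_optimal hinter hn hopt hε hX,
    fun hopt => ?_⟩
  have hw : ∀ x : IODL.State U, IODL.virtualWelfare U F x = 1 - IODL.potential F x :=
    fun _ => rfl
  simp only [hw, sub_le_sub_iff_left]
  exact h.isStochasticallyStableSet hinter hn (fun u hu => (hF u hu).2) hopt
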